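/- **Setting.** There are $K\ge 1$ arms and losses $\ell_t\in[0,1]^K$, $t=1,2,\dots$, possibly random and oblivious (they do not react to the arms drawn by the learner), and a deterministic sequence $(\lambda_n)_{n\ge1}$ of non-negative switching costs. Put $$a_n=\sum_{s=1}^n\Big(\lambda_s+\sqrt{K/s}\Big),\qquad \eta_n=\frac{2\sqrt{2K}}{3a_n},\qquad |B_n|=\max\Big\{\Big\lceil\sqrt{\lambda_n a_n/K}\,\Big\rceil,1\Big\},$$ and let $B_1,B_2,\dots$ be consecutive blocks of rounds of these lengths. Tsallis-Switch starts with $\tilde C_0=0$; in block $n$ it computes $$p_n=\arg\min_{p}\Big\{\langle p,\tilde C_{n-1}\rangle-\sum_{i=1}^K\frac{4\sqrt{p_i}-2p_i}{\eta_n}\Big\}$$ over the probability simplex, draws $I_n\sim p_n$, plays $I_n$ in all rounds of $B_n$, and sets $\tilde C_n(i)=\tilde C_{n-1}(i)+\frac{\mathbf 1[I_n=i]}{p_{n,i}}\sum_{t\in B_n}\ell_{t,i}$ for every $i$. Let $J_t$ be the arm played in round $t$. For a horizon $T$ let $N$ be the smallest integer with $\sum_{n=1}^N|B_n|\ge T$.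 The first draw always counts as a switch ($I_0$ is not an arm), and the pseudo-regret with switching costs is $$R\big(T,(\lambda_n)\big)=\mathbb E\Big[\sum_{t=1}^T\ell_{t,J_t}\Big]-\min_i\mathbb E\Big[\sum_{t=1}^T\ell_{t,i}\Big]+\sum_{n=1}^N\lambda_n\Pr(I_n\ne I_{n-1}).$$ Let $b_n=|B_n|$ for $n<N$ and let $b_N$ be the length of the last block truncated so that $b_1+\dots+b_N=T$. **Theorem.** For every $T$, $$R\big(T,(\lambda_n)\big)\le\sum_{n=1}^N7\lambda_n+12\sqrt{KN}+2 .$$ Suppose furthermore that the losses are stochastically constrained, i.e. there are constants $\Delta_{i,j}$ such that in every round $t$ the loss vector is drawn from a distribution with $\mathbb E[\ell_{t,i}-\ell_{t,j}\mid\ell_1,\dots,\ell_{t-1}]=\Delta_{i,j}$ almost surely for all $i,j$ (for losses independent over the rounds: $\mathbb E[\ell_{t,i}-\ell_{t,j}]=\Delta_{i,j}$), and that there is a unique best arm $i^*$, i.e. the gaps $\Delta_i=\Delta_{i,1}-\min_j\Delta_{j,1}$ vanish exactly for $i=i^*$. Then also $$R\big(T,(\lambda_n)\big)\le\sum_{n=1}^N\sum_{i\ne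 i^*}\frac{\big(11\lambda_n+\lambda_{n+1}+\frac{10\sqrt2}{\sqrt n}\big)^2}{4\Delta_i b_n}+\sum_{n=1}^{N_0}\frac{2\sqrt2\,\lambda_n}{\sqrt K}+4\sqrt{2N_0}+\lambda_1+2,$$ where $N_0$ is the smallest $m\in\{1,\dots,N\}$ such that $\eta_nb_n\le\frac14$ for all $m\le n\le N$, and $N_0=N$ if there is no such $m$. -/

import Mathlib

open MeasureTheory

namespace TsallisSwitch

/-! ### Blocks

Rounds `t` and blocks `n` are numbered from `1`. -/

/-- The number of rounds in the first `n` blocks, for block lengths `B 1, B 2, …`. -/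
def roundsUpTo (B : ℕ → ℕ) (n : ℕ) : ℕ := ∑ m ∈ Finset.Icc 1 n, B m

/-- The smallest `N` such that the first `N` blocks cover the first `t` rounds. For a round `t ≥ 1`
this is the index of the block that contains `t`; for a horizon `T` it is the number of blocks. -/
noncomputable def numBlocks (B : ℕ → ℕ) (t : ℕ) : ℕ := sInf {N | t ≤ roundsUpTo B N}

/-- The rounds that form the (full) block `n ≥ 1`. -/
def block (B : ℕ → ℕ) (n : ℕ) : Finset ℕ := Finset.Ioc (roundsUpTo B (n - 1)) (roundsUpTo B n)

/-- The length of block `n` in a game of `T` rounds: the last block is truncated, so that the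
lengths of the blocks `1, …, numBlocks B T` sum up to `T`. -/
def truncLen (B : ℕ → ℕ) (T n : ℕ) : ℕ := min (B n) (T - roundsUpTo B (n - 1))

/-! ### The algorithm -/

section Algorithm

variable {K : ℕ}

/-- The regularized objective `⟨p, C⟩ - ∑ i, (4 √(p i) - 2 p i) / η`. -/
noncomputable def objective (η : ℝ) (C p : Fin K → ℝ) : ℝ :=
  ∑ i, p i * C i - ∑ i, (4 * √(p i) - 2 * p i) / η

theorem exists_isMinOn_objective [NeZero K] (η : ℝ) (C : Fin K → ℝ) :
    ∃ p ∈ stdSimplex ℝ (Fin K), IsMinOn (objective η C) (stdSimplex ℝ (Fin K)) p := by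
  refine (isCompact_stdSimplex ℝ (Fin K)).exists_isMinOn ⟨_, single_mem_stdSimplex ℝ 0⟩ ?_
  unfold objective
  fun_prop

/-- For `η > 0` the minimizer over the simplex is unique. -/
theorem eq_of_isMinOn_objective {η : ℝ} (hη : 0 < η) {C p q : Fin K → ℝ}
    (hp : p ∈ stdSimplex ℝ (Fin K)) (hq : q ∈ stdSimplex ℝ (Fin K))
    (hpm : IsMinOn (objective η C) (stdSimplex ℝ (Fin K)) p)
    (hqm : IsMinOn (objective η C) (stdSimplex ℝ (Fin K)) q) : p = q := by
  by_contra hne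
  have hm : (fun i => (p i + q i) / 2) ∈ stdSimplex ℝ (Fin K) := by
    refine ⟨fun i => by have := hp.1 i; have := hq.1 i; positivity, ?_⟩
    rw [← Finset.sum_div, Finset.sum_add_distrib, hp.2, hq.2]; norm_num
  have h1 : objective η C p ≤ _ := hpm hm
  have h2 : objective η C q ≤ _ := hqm hm
  obtain ⟨i, hi⟩ := Function.ne_iff.mp hne
  have key : ∀ j, √(p j) + √(q j) ≤ 2 * √((p j + q j) / 2) ∧
      (p j ≠ q j → √(p j) + √(q j) < 2 * √((p j + q j) / 2)) := by
    intro j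
    have hpj := hp.1 j
    have hqj := hq.1 j
    have e1 := Real.sq_sqrt hpj
    have e2 := Real.sq_sqrt hqj
    have e3 := Real.sq_sqrt (show 0 ≤ (p j + q j) / 2 by positivity)
    refine ⟨abs_le_of_sq_le_sq' ?_ (by positivity) |>.2, fun hj => ?_⟩
    · nlinarith [sq_nonneg (√(p j) - √(q j))]
    · have : √(p j) - √(q j) ≠ 0 := fun h => hj (by
        rw [← e1, ← e2, sub_eq_zero.mp h])
      refine lt_of_pow_lt_pow_left₀ 2 (by positivity) ?_
      nlinarith [sq_pos_of_ne_zero this]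
  have hlt : ∑ j, (√(p j) + √(q j)) < ∑ j, 2 * √((p j + q j) / 2) :=
    Finset.sum_lt_sum (fun j _ => (key j).1) ⟨i, Finset.mem_univ i, (key i).2 hi⟩
  have hlt' := div_lt_div_of_pos_right hlt hη
  have hsum : objective η C p + objective η C q
      - 2 * objective η C (fun i => (p i + q i) / 2)
      = 4 * ((∑ j, 2 * √((p j + q j) / 2)) / η - (∑ j, (√(p j) + √(q j))) / η) := by
    unfold objective
    simp only [Finset.sum_div, Finset.mul_sum, ← Finset.sum_sub_distrib, ← Finset.sum_add_distrib]
    refine Finset.sum_congr rfl fun j _ => ?_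
    ring
  linarith

/-- The distribution `argmin_{p ∈ Δ} ⟨p, C⟩ - ∑ i, (4 √(p i) - 2 p i) / η` over the arms. -/
noncomputable def tsallisDist [NeZero K] (η : ℝ) (C : Fin K → ℝ) : Fin K → ℝ :=
  (exists_isMinOn_objective η C).choose

theorem tsallisDist_spec [NeZero K] (η : ℝ) (C : Fin K → ℝ) :
    tsallisDist η C ∈ stdSimplex ℝ (Fin K) ∧
      IsMinOn (objective η C) (stdSimplex ℝ (Fin K)) (tsallisDist η C) :=
  (exists_isMinOn_objective η C).choose_spec

/-- The cumulative loss of arm `i` in block `n`. -/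
def blockLoss (B : ℕ → ℕ) (loss : ℕ → Fin K → ℝ) (n : ℕ) (i : Fin K) : ℝ :=
  ∑ t ∈ block B n, loss t i

/-- The cumulative importance-weighted loss estimates after `n` blocks, when the block losses are
`c` and the arms played in the blocks are `I`. -/
noncomputable def cumEst [NeZero K] (η : ℕ → ℝ) (c : ℕ → Fin K → ℝ) (I : ℕ → Fin K) :
    ℕ → Fin K → ℝ
  | 0 => 0
  | n + 1 => fun i => cumEst η c I n i +
      if I (n + 1) = i then c (n + 1) i / tsallisDist (η (n + 1)) (cumEst η c I n) i else 0

/-- The distribution from which the algorithm draws the arm of block `n ≥ 1`, given the loss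
sequence and the arms `I 1, …, I (n - 1)` of the previous blocks. -/
noncomputable def playDist [NeZero K] (η : ℕ → ℝ) (B : ℕ → ℕ) (loss : ℕ → Fin K → ℝ)
    (I : ℕ → Fin K) (n : ℕ) : Fin K → ℝ :=
  tsallisDist (η n) (cumEst η (blockLoss B loss) I (n - 1))

end Algorithm

/-! ### The game -/

section Game

variable {K : ℕ} {Ω : Type*}

/-- `loss t ω i` is the loss of arm `i` in round `t ≥ 1`: a random vector in `[0, 1]^K`. -/
structure IsLossProcess [MeasurableSpace Ω] (loss : ℕ → Ω → Fin K → ℝ) : Prop where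
  measurable : ∀ t, 1 ≤ t → Measurable (loss t)
  mem_Icc : ∀ t, 1 ≤ t → ∀ ω i, loss t ω i ∈ Set.Icc (0 : ℝ) 1

/-- The information on which the draw in block `n` is conditioned: the whole loss sequence and the
arms of the previous blocks. -/
abbrev history (loss : ℕ → Ω → Fin K → ℝ) (I : ℕ → Ω → Fin K) (n : ℕ) : MeasurableSpace Ω :=
  (⨆ t, ⨆ _ : 1 ≤ t, MeasurableSpace.comap (loss t) inferInstance) ⊔
    ⨆ m, ⨆ _ : 1 ≤ m ∧ m < n, MeasurableSpace.comap (I m) inferInstance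

/-- `I 1, I 2, …` are the arms that the algorithm with learning rates `η` and block lengths `B`
plays in its blocks against the (possibly random) oblivious losses `loss`: conditionally on the
losses and on `I 1, …, I (n - 1)`, the arm `I n` has the law computed by the algorithm. Since the
conditioning includes the whole loss sequence, the losses do not react to the draws. -/
structure IsTsallisSwitch [NeZero K] [MeasurableSpace Ω] (μ : Measure Ω) (η : ℕ → ℝ) (B : ℕ → ℕ)
    (loss : ℕ → Ω → Fin K → ℝ) (I : ℕ → Ω → Fin K) : Prop where
  measurable : ∀ n, 1 ≤ n → Measurable (I n)
  law : ∀ n, 1 ≤ n → ∀ i,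
    μ[Set.indicator {ω | I n ω = i} (fun _ => (1 : ℝ)) | history loss I n] =ᵐ[μ]
      fun ω => playDist η B (fun t => loss t ω) (fun m => I m ω) n i

/-- The arm played before block `n`; there is none before the first block, so that the first draw
always counts as a switch. -/
def prevArm (I : ℕ → Ω → Fin K) (n : ℕ) (ω : Ω) : Option (Fin K) :=
  if n ≤ 1 then none else some (I (n - 1) ω)

/-- The pseudo-regret without switching costs over `T` rounds, when the arm `I n` is played in all
rounds of block `n`. -/
noncomputable def pseudoRegret [MeasurableSpace Ω] (μ : Measure Ω) (B : ℕ → ℕ)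
    (loss : ℕ → Ω → Fin K → ℝ) (I : ℕ → Ω → Fin K) (T : ℕ) : ℝ :=
  (∫ ω, (∑ t ∈ Finset.Icc 1 T, loss t ω (I (numBlocks B t) ω)) ∂μ) -
    ⨅ i : Fin K, ∫ ω, (∑ t ∈ Finset.Icc 1 T, loss t ω i) ∂μ

/-- The expected cumulative switching cost over `T` rounds, the `n`-th cost being `lam n`. -/
noncomputable def switchingCost [MeasurableSpace Ω] (μ : Measure Ω) (B : ℕ → ℕ) (lam : ℕ → ℝ)
    (I : ℕ → Ω → Fin K) (T : ℕ) : ℝ :=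
  ∑ n ∈ Finset.Icc 1 (numBlocks B T), lam n * μ.real {ω | some (I n ω) ≠ prevArm I n ω}

/-- The pseudo-regret with switching costs. -/
noncomputable def regretWithSwitching [MeasurableSpace Ω] (μ : Measure Ω) (B : ℕ → ℕ)
    (lam : ℕ → ℝ) (loss : ℕ → Ω → Fin K → ℝ) (I : ℕ → Ω → Fin K) (T : ℕ) : ℝ :=
  pseudoRegret μ B loss I T + switchingCost μ B lam I T

/-! ### The stochastically constrained adversarial regime -/

/-- The losses of the rounds `1, …, t - 1`. -/
abbrev pastLosses (loss : ℕ → Ω → Fin K → ℝ) (t : ℕ) : MeasurableSpace Ω :=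
  ⨆ s, ⨆ _ : 1 ≤ s ∧ s < t, MeasurableSpace.comap (loss s) inferInstance

/-- Stochastically constrained adversarial regime: in every round the loss vector is drawn, given
the losses of the past, from a distribution whose gaps `𝔼[loss t i - loss t j] = D i j` do not
depend on the round, while the means themselves may fluctuate. For loss vectors that are
independent over the rounds this is the condition on the unconditional expectations. -/
def StochasticallyConstrained [MeasurableSpace Ω] (μ : Measure Ω) (loss : ℕ → Ω → Fin K → ℝ)
    (D : Fin K → Fin K → ℝ) : Prop :=
  ∀ t, 1 ≤ t → ∀ i j,
    μ[fun ω => loss t ω i - loss t ω j | pastLosses loss t] =ᵐ[μ] fun _ => D i j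

/-- The suboptimality gaps, measured relative to the first arm. -/
noncomputable def gap [NeZero K] (D : Fin K → Fin K → ℝ) (i : Fin K) : ℝ := D i 0 - ⨅ j, D j 0

/-- `istar` is the unique best arm. -/
def IsUniqueBestArm [NeZero K] (D : Fin K → Fin K → ℝ) (istar : Fin K) : Prop :=
  ∀ i, gap D i = 0 ↔ i = istar

end Game

/-! ### The tuning for varying switching costs -/

/-- `a n = ∑_{s ≤ n} (lam s + √(K / s))`. -/
noncomputable def aSeq (K : ℕ) (lam : ℕ → ℝ) (n : ℕ) : ℝ :=
  ∑ s ∈ Finset.Icc 1 n, (lam s + √((K : ℝ) / (s : ℝ)))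

/-- The learning rates `2 √(2 K) / (3 a n)`. -/
noncomputable def etaSeq (K : ℕ) (lam : ℕ → ℝ) (n : ℕ) : ℝ :=
  2 * √(2 * (K : ℝ)) / (3 * aSeq K lam n)

/-- The block lengths `max {⌈√(lam n * a n / K)⌉, 1}`. -/
noncomputable def lenSeq (K : ℕ) (lam : ℕ → ℝ) (n : ℕ) : ℕ :=
  max ⌈√(lam n * aSeq K lam n / (K : ℝ))⌉₊ 1

/-- The admissible starting points: the block indices `m` with `1 ≤ m ≤ N` such that `η n` times
the length of block `n` is at most `1/4` for all `n` from `m` up to the last block `N`. -/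
def smallStepSet (η : ℕ → ℝ) (B : ℕ → ℕ) (T : ℕ) : Set ℕ :=
  {m | 1 ≤ m ∧ m ≤ numBlocks B T ∧
    ∀ n, m ≤ n → n ≤ numBlocks B T → η n * (truncLen B T n : ℝ) ≤ 1 / 4}

open Classical in
/-- The smallest admissible starting point, and the number of blocks if there is none. -/
noncomputable def smallStepIndex (η : ℕ → ℝ) (B : ℕ → ℕ) (T : ℕ) : ℕ :=
  if (smallStepSet η B T).Nonempty then sInf (smallStepSet η B T) else numBlocks B T

end TsallisSwitch

/-! Treat each block as one round of follow the regularized leader with the 1/2-Tsallis entropy. Let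
`Φ_n(C)` be the minimum of the objective with rate `η n`. The first-order conditions `C i = ν + 2 /
(η √(p i))` turn the excess of the objective over its minimum into a Bregman divergence. Hence the
loss of a block is at most the increase of `Φ_n` plus a stability term
(`inner_le_minObjective_add_stability`). Telescoping over the blocks leaves a penalty for each
change of `1 / η n` (`sum_le_cumEst_add`). The loss estimates are unbiased, so expectations yield a
bound on the pseudo-regret (`IsBlockGame.expected_regret_le`).

With the given tuning, `η n * b n ^ 2` and the increment of `1 / η n` are both at most constants
times `y_n = lam n / √K + 1 / √n`. In the adversarial case `∑ √(p i) ≤ √K` bounds a block by `6 * √K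
* y_n`. Charging every block for a switch adds one more `lam n`.

In the stochastic case the best arm `k` has to drop out of the bounds. The penalty is `4 ∑ √(p i) -
4 ≤ 4 ∑_{i ≠ k} √(p i)`. Shifting the estimates by the observed loss does the same for the stability
term once `η n * b n ≤ 1/4`; the earlier blocks cost an extra `η n * b n ^ 2` each. A switch
requires a suboptimal arm before or after it (`sum_switching_le`). Finally the regret is written as
twice itself minus itself: twice the upper bound, minus the exact value `∑ b n * Δ i * 𝔼 p i`
(`pseudoRegret_eq_sum_gap`). For each arm this is a concave quadratic in `√(p i)` up to the
switching term, and its maximum gives the summands `M ^ 2 / (4 * Δ i * b n)` (`self_bounding_le`).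

The exact value of the regret is delicate: a gap is known only conditionally on past losses, whereas
the draws are specified given all losses. `integral_path_mul` bridges this by removing the draws one
at a time. -/

namespace TsallisSwitch

/-! ### The minimizer of the regularized objective -/

section Minimizer

variable {K : ℕ}

/-- Under the first-order conditions the objective exceeds its value at `p` by the Bregman
divergence of the regularizer. -/
theorem objective_eq_add_bregman {η : ℝ} (hη : 0 < η) {C p q : Fin K → ℝ} {ν : ℝ}
    (hp : p ∈ stdSimplex ℝ (Fin K)) (hq : q ∈ stdSimplex ℝ (Fin K)) (hpos : ∀ i, 0 < p i)
    (hν : ∀ i, C i = ν + 2 / (η * √(p i))) :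
    objective η C q = objective η C p + ∑ i, 2 * (√(q i) - √(p i)) ^ 2 / (η * √(p i)) := by
  have key : ∀ i, q i * C i - (4 * √(q i) - 2 * q i) / η =
      (p i * C i - (4 * √(p i) - 2 * p i) / η) + 2 * (√(q i) - √(p i)) ^ 2 / (η * √(p i))
        + (ν + 2 / η) * (q i - p i) := by
    intro i
    have hs : 0 < √(p i) := Real.sqrt_pos.mpr (hpos i)
    have e1 := Real.sq_sqrt (hq.1 i)
    have e2 := Real.sq_sqrt (hpos i).le
    rw [hν i]
    generalize √(q i) = x at *
    generalize √(p i) = s at *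
    rw [← e1, ← e2]
    field_simp
    ring
  have hz : ∑ i, (ν + 2 / η) * (q i - p i) = 0 := by
    rw [← Finset.mul_sum, Finset.sum_sub_distrib, hp.2, hq.2, sub_self, mul_zero]
  unfold objective
  rw [← Finset.sum_sub_distrib, ← Finset.sum_sub_distrib, Finset.sum_congr rfl fun i _ => key i,
    Finset.sum_add_distrib, Finset.sum_add_distrib, hz, add_zero]

variable [NeZero K]

/-- The summands are the probabilities that the first-order conditions dictate for a multiplier `ν`.
With `C k` the smallest entry, each of them is at most `1 / K` at `ν = C k - 2 √K / η`, and the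
`k`-th equals `1` at `ν = C k - 2 / η`; the intermediate value theorem does the rest. -/
theorem exists_normalizer {η : ℝ} (hη : 0 < η) (C : Fin K → ℝ) :
    ∃ ν, (∀ i, ν < C i) ∧ ∑ i, (2 / (η * (C i - ν))) ^ 2 = 1 := by
  obtain ⟨k, hk⟩ := Finite.exists_min C
  have hK : (1 : ℝ) ≤ K := by exact_mod_cast NeZero.one_le
  have hsK : (1 : ℝ) ≤ √K := Real.one_le_sqrt.mpr hK
  have hlt : ∀ ν ∈ Set.Icc (C k - 2 * √K / η) (C k - 2 / η), ∀ i, ν < C i := by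
    intro ν hν i
    have : 0 < 2 / η := by positivity
    linarith [hk i, hν.2]
  have hab : C k - 2 * √K / η ≤ C k - 2 / η := by
    have : 2 / η ≤ 2 * √K / η := by gcongr; linarith
    linarith
  have hcont : ContinuousOn (fun ν => ∑ i, (2 / (η * (C i - ν))) ^ 2)
      (Set.Icc (C k - 2 * √K / η) (C k - 2 / η)) := by
    refine continuousOn_finsetSum _ fun i _ => ContinuousOn.pow (ContinuousOn.div
      (by fun_prop) (by fun_prop) fun ν hν => ?_) 2
    exact mul_ne_zero hη.ne' (sub_ne_zero.mpr (hlt ν hν i).ne')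
  obtain ⟨ν, hν, h1⟩ := intermediate_value_Icc hab hcont (show (1 : ℝ) ∈ Set.Icc _ _ from by
    constructor
    · have : ∀ i ∈ Finset.univ, (2 / (η * (C i - (C k - 2 * √K / η)))) ^ 2 ≤ 1 / (K : ℝ) := by
        intro i _
        have h0 : 2 * √K ≤ η * (C i - (C k - 2 * √K / η)) := by
          have : η * (C i - (C k - 2 * √K / η)) = η * (C i - C k) + 2 * √K := by field_simp; ring
          rw [this]
          nlinarith [mul_nonneg hη.le (sub_nonneg.mpr (hk i))]
        have h2 : 2 / (η * (C i - (C k - 2 * √K / η))) ≤ 1 / √K := by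
          rw [div_le_div_iff₀ (by linarith) (by linarith)]; linarith
        calc _ ≤ (1 / √(K : ℝ)) ^ 2 :=
              pow_le_pow_left₀ (div_nonneg (by norm_num) (by linarith)) h2 2
          _ = 1 / (K : ℝ) := by rw [div_pow, Real.sq_sqrt (by linarith), one_pow]
      refine (Finset.sum_le_sum this).trans ?_
      simp only [Finset.sum_const, Finset.card_univ, Fintype.card_fin, nsmul_eq_mul]
      rw [mul_one_div_cancel (by linarith)]
    · have h0 : (2 / (η * (C k - (C k - 2 / η)))) ^ 2 = 1 := by
        have : η * (C k - (C k - 2 / η)) = 2 := by field_simp; ring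
        rw [this]; norm_num
      show 1 ≤ ∑ i, (2 / (η * (C i - (C k - 2 / η)))) ^ 2
      rw [← h0]
      exact Finset.single_le_sum (f := fun i => (2 / (η * (C i - (C k - 2 / η)))) ^ 2)
        (fun i _ => sq_nonneg _) (Finset.mem_univ k))
  exact ⟨ν, hlt ν hν, h1⟩

theorem tsallisDist_first_order {η : ℝ} (hη : 0 < η) (C : Fin K → ℝ) :
    (∀ i, 0 < tsallisDist η C i) ∧ ∃ ν, ∀ i, C i = ν + 2 / (η * √(tsallisDist η C i)) := by
  obtain ⟨ν, hlt, hsum⟩ := exists_normalizer hη C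
  set p : Fin K → ℝ := fun i => (2 / (η * (C i - ν))) ^ 2 with hpdef
  have hb : ∀ i, 0 < 2 / (η * (C i - ν)) := fun i =>
    div_pos two_pos (mul_pos hη (sub_pos.mpr (hlt i)))
  have hpos : ∀ i, 0 < p i := fun i => pow_pos (hb i) 2
  have hp : p ∈ stdSimplex ℝ (Fin K) := ⟨fun i => (hpos i).le, hsum⟩
  have hν : ∀ i, C i = ν + 2 / (η * √(p i)) := by
    intro i
    have := sub_pos.mpr (hlt i)
    rw [hpdef]
    simp only
    rw [Real.sqrt_sq (hb i).le]
    field_simp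
    ring
  have hmin : IsMinOn (objective η C) (stdSimplex ℝ (Fin K)) p := fun q hq => by
    show objective η C p ≤ objective η C q
    rw [objective_eq_add_bregman hη hp hq hpos hν]
    exact le_add_of_nonneg_right (Finset.sum_nonneg fun i _ => by positivity)
  have : tsallisDist η C = p := eq_of_isMinOn_objective hη (tsallisDist_spec η C).1 hp
    (tsallisDist_spec η C).2 hmin
  rw [this]
  exact ⟨hpos, ν, hν⟩

theorem tsallisDist_pos {η : ℝ} (hη : 0 < η) (C : Fin K → ℝ) (i : Fin K) :
    0 < tsallisDist η C i := (tsallisDist_first_order hη C).1 i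

theorem tsallisDist_sum (η : ℝ) (C : Fin K → ℝ) : ∑ i, tsallisDist η C i = 1 :=
  (tsallisDist_spec η C).1.2

theorem tsallisDist_nonneg (η : ℝ) (C : Fin K → ℝ) (i : Fin K) : 0 ≤ tsallisDist η C i :=
  (tsallisDist_spec η C).1.1 i

theorem tsallisDist_le_one (η : ℝ) (C : Fin K → ℝ) (i : Fin K) : tsallisDist η C i ≤ 1 := by
  rw [← tsallisDist_sum η C]
  exact Finset.single_le_sum (fun j _ => tsallisDist_nonneg η C j) (Finset.mem_univ i)

/-- Subtracting the first-order conditions of two arms eliminates `ν`; comparison with an arm of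
probability at least `1 / K` gives the bound. It keeps the importance weights bounded, so that
everything is integrable. -/
theorem inv_sqrt_tsallisDist_le {η : ℝ} (hη : 0 < η) {C : Fin K → ℝ} (hC : ∀ i, 0 ≤ C i)
    (i : Fin K) : (√(tsallisDist η C i))⁻¹ ≤ √K + η / 2 * C i := by
  obtain ⟨hpos, ν, hν⟩ := tsallisDist_first_order hη C
  have hK : (0 : ℝ) < K := by exact_mod_cast NeZero.pos K
  obtain ⟨j, -, hj⟩ : ∃ j ∈ Finset.univ, 1 / (K : ℝ) ≤ tsallisDist η C j := by
    refine Finset.exists_le_of_sum_le (Finset.univ_nonempty) ?_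
    rw [tsallisDist_sum]
    simp [hK.ne']
  have h1 : (√(tsallisDist η C j))⁻¹ ≤ √K := by
    rw [← Real.sqrt_inv]
    apply Real.sqrt_le_sqrt
    rw [inv_le_comm₀ (hpos j) hK, ← one_div]
    exact hj
  have h2 : (√(tsallisDist η C i))⁻¹ = η / 2 * (C i - C j) + (√(tsallisDist η C j))⁻¹ := by
    have a1 : √(tsallisDist η C i) ≠ 0 := (Real.sqrt_pos.mpr (hpos i)).ne'
    have a2 : √(tsallisDist η C j) ≠ 0 := (Real.sqrt_pos.mpr (hpos j)).ne'
    rw [hν i, hν j]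
    field_simp
    ring
  have := mul_nonneg hη.le (hC j)
  rw [h2]
  linarith

/-- By uniqueness of the minimizer the graph is an intersection of closed sets, and a map into a
compact space with closed graph is continuous. This provides the measurability of the sampling
distributions. -/
theorem continuous_tsallisDist {η : ℝ} (hη : 0 < η) :
    Continuous (tsallisDist η : (Fin K → ℝ) → Fin K → ℝ) := by
  set S := stdSimplex ℝ (Fin K)
  have : CompactSpace S := isCompact_iff_compactSpace.mp (isCompact_stdSimplex ℝ (Fin K))
  set f : (Fin K → ℝ) → S := fun C => ⟨tsallisDist η C, (tsallisDist_spec η C).1⟩ with hf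
  suffices Continuous f from continuous_subtype_val.comp this
  have hgraph : IsClosed {x : (Fin K → ℝ) × S | f x.1 = x.2} := by
    have : {x : (Fin K → ℝ) × S | f x.1 = x.2} =
        ⋂ q : S, {x | objective η x.1 x.2 ≤ objective η x.1 q} := by
      ext ⟨C, p⟩
      simp only [Set.mem_ofPred_eq, Set.mem_iInter]
      constructor
      · rintro rfl q
        exact (tsallisDist_spec η C).2 q.2
      · intro h
        exact Subtype.ext (eq_of_isMinOn_objective hη (tsallisDist_spec η C).1 p.2
          (tsallisDist_spec η C).2 fun q hq => h ⟨q, hq⟩)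
    rw [this]
    have hobj : Continuous fun x : (Fin K → ℝ) × (Fin K → ℝ) => objective η x.1 x.2 := by
      unfold objective
      fun_prop
    exact isClosed_iInter fun q => isClosed_le
      (hobj.comp (continuous_fst.prodMk (continuous_subtype_val.comp continuous_snd)))
      (hobj.comp (continuous_fst.prodMk continuous_const))
  refine continuous_iff_isClosed.mpr fun U hU => ?_
  have : f ⁻¹' U = Prod.fst '' ({x : (Fin K → ℝ) × S | f x.1 = x.2} ∩ Prod.snd ⁻¹' U) := by
    ext C
    constructor
    · exact fun h => ⟨(C, f C), ⟨rfl, h⟩, rfl⟩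
    · rintro ⟨⟨C', p⟩, ⟨h, hp⟩, rfl⟩
      simp only [Set.mem_ofPred_eq] at h
      simpa [h] using hp
  rw [this]
  exact isClosedMap_fst_of_compactSpace _ (hgraph.inter (hU.preimage continuous_snd))

end Minimizer

/-! ### Pathwise regret bounds -/

section Pathwise

variable {K : ℕ}

/-- Completing the square in `x`: the left side is a concave quadratic with maximizer `x = s / (1 +
η s c / 2)`. It is used with `s = √(p i)` and `x = √(q i)`. -/
theorem stability_scalar {η s x c : ℝ} (hη : 0 < η) (hs : 0 < s)
    (hu : 0 < 1 + η * s * c / 2) :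
    (s ^ 2 - x ^ 2) * c - 2 * (x - s) ^ 2 / (η * s) ≤
      η * s ^ 3 * c ^ 2 / (2 * (1 + η * s * c / 2)) := by
  have h : η * s ^ 3 * c ^ 2 / (2 * (1 + η * s * c / 2)) -
      ((s ^ 2 - x ^ 2) * c - 2 * (x - s) ^ 2 / (η * s)) =
      2 * (1 + η * s * c / 2) / (η * s) * (x - s / (1 + η * s * c / 2)) ^ 2 := by
    have hu' : 2 + η * s * c ≠ 0 := by linarith
    have : 1 + η * s * c / 2 = (2 + η * s * c) / 2 := by ring
    rw [this]
    field_simp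
    ring
  have : 0 ≤ 2 * (1 + η * s * c / 2) / (η * s) * (x - s / (1 + η * s * c / 2)) ^ 2 := by
    positivity
  linarith

theorem objective_of_mem_stdSimplex {η : ℝ} {C p : Fin K → ℝ} (hp : p ∈ stdSimplex ℝ (Fin K)) :
    objective η C p = ∑ i, p i * C i - (4 * ∑ i, √(p i) - 2) / η := by
  unfold objective
  rw [← Finset.sum_div, Finset.sum_sub_distrib, ← Finset.mul_sum, ← Finset.mul_sum, hp.2, mul_one]

/-- The importance-weighted estimate of the loss vector `c` when the arm `a` is drawn from `p`. -/
noncomputable def lossEst (p c : Fin K → ℝ) (a i : Fin K) : ℝ := if a = i then c i / p i else 0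

theorem sum_mul_lossEst {p : Fin K → ℝ} (hp : ∀ i, 0 < p i) (c : Fin K → ℝ) (a : Fin K) :
    ∑ i, p i * lossEst p c a i = c a := by
  rw [Finset.sum_eq_single a]
  · simp [lossEst, mul_div_cancel₀ _ (hp a).ne']
  · intro i _ h; simp [lossEst, h.symm]
  · simp

/-- The stability term of importance-weighted losses. -/
noncomputable def ivBound (η : ℝ) (p c : Fin K → ℝ) (i : Fin K) : ℝ := η / 2 * c i ^ 2 / √(p i)

/-- The stability term of importance-weighted losses that are shifted by the observed loss. -/
noncomputable def shiftedBound (η : ℝ) (p c : Fin K → ℝ) (i : Fin K) : ℝ :=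
  η * c i ^ 2 * ((1 - p i) ^ 2 / (2 * √(p i)) + 4 / 7 * ∑ j ∈ Finset.univ.erase i, √(p j) ^ 3)

theorem sum_mul_ivBound_le {η b : ℝ} {p c : Fin K → ℝ} (hη : 0 < η) (hp : ∀ i, 0 < p i)
    (hc : ∀ i, c i ∈ Set.Icc 0 b) :
    ∑ i, p i * ivBound η p c i ≤ η / 2 * b ^ 2 * ∑ i, √(p i) := by
  rw [Finset.mul_sum]
  refine Finset.sum_le_sum fun i _ => ?_
  have hs : 0 < √(p i) := Real.sqrt_pos.mpr (hp i)
  have h2 : c i ^ 2 ≤ b ^ 2 := pow_le_pow_left₀ (hc i).1 (hc i).2 2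
  calc p i * ivBound η p c i = η / 2 * c i ^ 2 * √(p i) := by
        have e := Real.sq_sqrt (hp i).le
        rw [ivBound]
        generalize √(p i) = s at *
        rw [← e]
        field_simp
    _ ≤ _ := by gcongr

/-- The term of `k` is at most `1 - p k = ∑_{i ≠ k} p i`, so it is paid for by the other arms. This
is what removes the best arm from the stability term. -/
theorem sum_sqrt_mul_one_sub_le {p : Fin K → ℝ} (hp : p ∈ stdSimplex ℝ (Fin K)) (k : Fin K) :
    ∑ i, √(p i) * (1 - p i) ≤ 2 * ∑ i ∈ Finset.univ.erase k, √(p i) := by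
  have hle : ∀ i, p i ≤ 1 := fun i => by
    rw [← hp.2]; exact Finset.single_le_sum (fun j _ => hp.1 j) (Finset.mem_univ i)
  have hsle : ∀ i, p i ≤ √(p i) := fun i => by
    have := Real.sqrt_le_one.mpr (hle i)
    nlinarith [Real.sq_sqrt (hp.1 i), Real.sqrt_nonneg (p i)]
  rw [← Finset.add_sum_erase _ _ (Finset.mem_univ k), two_mul]
  refine add_le_add ?_ (Finset.sum_le_sum fun i _ => ?_)
  · have h1 : 1 - p k = ∑ i ∈ Finset.univ.erase k, p i := by
      rw [← hp.2, ← Finset.add_sum_erase _ _ (Finset.mem_univ k)]; ring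
    calc √(p k) * (1 - p k) ≤ 1 * (1 - p k) :=
          mul_le_mul_of_nonneg_right (Real.sqrt_le_one.mpr (hle k)) (sub_nonneg.mpr (hle k))
      _ ≤ _ := by rw [one_mul, h1]; exact Finset.sum_le_sum fun i _ => hsle i
  · exact mul_le_of_le_one_right (Real.sqrt_nonneg _) (by linarith [hp.1 i])

theorem sum_mul_shiftedBound_le {η b : ℝ} {p c : Fin K → ℝ} (hη : 0 < η)
    (hp : p ∈ stdSimplex ℝ (Fin K)) (hpos : ∀ i, 0 < p i) (hc : ∀ i, c i ∈ Set.Icc 0 b) (k : Fin K) :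
    ∑ i, p i * shiftedBound η p c i ≤
      8 / 7 * (η * b ^ 2) * ∑ i ∈ Finset.univ.erase k, √(p i) := by
  have hle : ∀ i, p i ≤ 1 := fun i => by
    rw [← hp.2]; exact Finset.single_le_sum (fun j _ => hp.1 j) (Finset.mem_univ i)
  have h1 : ∀ i, p i * shiftedBound η p c i ≤ η * b ^ 2 * (√(p i) * (1 - p i) ^ 2 / 2 +
      4 / 7 * (p i * (∑ j, √(p j) ^ 3 - √(p i) ^ 3))) := by
    intro i
    have hs : 0 < √(p i) := Real.sqrt_pos.mpr (hpos i)
    have h2 : c i ^ 2 ≤ b ^ 2 := pow_le_pow_left₀ (hc i).1 (hc i).2 2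
    have h3 : ∑ j, √(p j) ^ 3 - √(p i) ^ 3 = ∑ j ∈ Finset.univ.erase i, √(p j) ^ 3 := by
      rw [← Finset.add_sum_erase _ _ (Finset.mem_univ i)]; ring
    have h4 : 0 ≤ ∑ j ∈ Finset.univ.erase i, √(p j) ^ 3 :=
      Finset.sum_nonneg fun j _ => by positivity
    have h5 := hpos i
    rw [h3]
    calc p i * shiftedBound η p c i = η * c i ^ 2 * (√(p i) * (1 - p i) ^ 2 / 2 +
          4 / 7 * (p i * ∑ j ∈ Finset.univ.erase i, √(p j) ^ 3)) := by
          have e := Real.sq_sqrt (hpos i).le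
          rw [shiftedBound]
          generalize ∑ j ∈ Finset.univ.erase i, √(p j) ^ 3 = A at *
          generalize √(p i) = s at *
          rw [← e]
          field_simp
      _ ≤ _ := by gcongr
  refine (Finset.sum_le_sum fun i _ => h1 i).trans ?_
  -- Exchanging the sums over `i` and `j ≠ i` produces the factor `1 - p j` in the second part as
  -- well.
  have h6 : ∑ i, (√(p i) * (1 - p i) ^ 2 / 2 + 4 / 7 * (p i * (∑ j, √(p j) ^ 3 - √(p i) ^ 3))) =
      ∑ i, √(p i) * (1 - p i) * ((1 - p i) / 2 + 4 / 7 * p i) := by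
    have : ∑ i, p i * (∑ j, √(p j) ^ 3 - √(p i) ^ 3) = ∑ i, √(p i) * p i * (1 - p i) := by
      simp only [mul_sub, Finset.sum_sub_distrib, ← Finset.sum_mul, hp.2, one_mul, mul_one]
      congr 1 <;> refine Finset.sum_congr rfl fun i _ => ?_
      · have e := Real.sq_sqrt (hp.1 i); generalize √(p i) = s at *; rw [← e]; ring
      · have e := Real.sq_sqrt (hp.1 i); generalize √(p i) = s at *; rw [← e]; ring
    rw [Finset.sum_add_distrib, ← Finset.mul_sum, this, Finset.mul_sum, ← Finset.sum_add_distrib]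
    refine Finset.sum_congr rfl fun i _ => ?_
    ring
  rw [← Finset.mul_sum, h6]
  have h7 : ∑ i, √(p i) * (1 - p i) * ((1 - p i) / 2 + 4 / 7 * p i) ≤
      4 / 7 * ∑ i, √(p i) * (1 - p i) := by
    rw [Finset.mul_sum]
    refine Finset.sum_le_sum fun i _ => ?_
    have : 0 ≤ √(p i) * (1 - p i) := mul_nonneg (Real.sqrt_nonneg _) (sub_nonneg.mpr (hle i))
    rw [mul_comm]
    exact mul_le_mul_of_nonneg_right (by linarith [hp.1 i, hle i]) this
  have h8 := sum_sqrt_mul_one_sub_le hp k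
  calc _ ≤ η * b ^ 2 * (4 / 7 * (2 * ∑ i ∈ Finset.univ.erase k, √(p i))) := by
        gcongr; linarith
    _ = _ := by ring

variable [NeZero K]

/-- The minimum of the regularized objective over the simplex. -/
noncomputable def minObjective (η : ℝ) (C : Fin K → ℝ) : ℝ := objective η C (tsallisDist η C)

theorem minObjective_le {η : ℝ} {C q : Fin K → ℝ} (hq : q ∈ stdSimplex ℝ (Fin K)) :
    minObjective η C ≤ objective η C q := (tsallisDist_spec η C).2 hq

/-- The loss is at most the change of the minimum of the objective plus a stability term, which
may be computed after a shift of the loss vector. -/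
theorem inner_le_minObjective_add_stability {η : ℝ} (hη : 0 < η) (C c : Fin K → ℝ) (z : ℝ)
    (hz : ∀ i, 0 < 1 + η * √(tsallisDist η C i) * (c i - z) / 2) :
    ∑ i, tsallisDist η C i * c i ≤ minObjective η (fun i => C i + c i) - minObjective η C +
      ∑ i, η * √(tsallisDist η C i) ^ 3 * (c i - z) ^ 2 /
        (2 * (1 + η * √(tsallisDist η C i) * (c i - z) / 2)) := by
  obtain ⟨hpos, ν, hν⟩ := tsallisDist_first_order hη C
  have hp := (tsallisDist_spec η C).1
  have hq := (tsallisDist_spec η (fun i => C i + c i)).1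
  set p := tsallisDist η C with hpdef
  set q := tsallisDist η (fun i => C i + c i) with hqdef
  have h1 : minObjective η (fun i => C i + c i) = objective η C q + ∑ i, q i * c i := by
    unfold minObjective objective
    rw [← hqdef]
    simp only [mul_add, Finset.sum_add_distrib]
    ring
  have h2 : minObjective η C = objective η C p := rfl
  rw [h1, h2, objective_eq_add_bregman hη hp hq hpos hν]
  -- Shifting by `z` is free because `p` and `q` have the same total mass.
  have h3 : ∑ i, p i * c i - ∑ i, q i * c i = ∑ i, (p i - q i) * (c i - z) := by
    simp only [sub_mul, mul_sub, Finset.sum_sub_distrib, ← Finset.sum_mul, hp.2, hq.2]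
    ring
  have h4 : ∑ i, ((p i - q i) * (c i - z) - 2 * (√(q i) - √(p i)) ^ 2 / (η * √(p i))) ≤
      ∑ i, η * √(p i) ^ 3 * (c i - z) ^ 2 / (2 * (1 + η * √(p i) * (c i - z) / 2)) := by
    refine Finset.sum_le_sum fun i _ => ?_
    have := stability_scalar (x := √(q i)) hη (Real.sqrt_pos.mpr (hpos i)) (hz i)
    rwa [Real.sq_sqrt (hpos i).le, Real.sq_sqrt (hq.1 i)] at this
  rw [Finset.sum_sub_distrib] at h4
  linarith

theorem le_minObjective_add_ivBound {η : ℝ} (hη : 0 < η) (C c : Fin K → ℝ) (a : Fin K)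
    (hc : 0 ≤ c a) :
    c a ≤ minObjective η (fun i => C i + lossEst (tsallisDist η C) c a i) - minObjective η C +
      ivBound η (tsallisDist η C) c a := by
  have hpos := tsallisDist_pos hη C
  set p := tsallisDist η C with hp
  have hnn : ∀ i, 0 ≤ lossEst p c a i := by
    intro i
    unfold lossEst
    split_ifs with h
    · exact h ▸ div_nonneg hc (hpos a).le
    · exact le_rfl
  have := inner_le_minObjective_add_stability hη C (lossEst p c a) 0 fun i => by
    rw [sub_zero]
    have := hnn i
    positivity
  rw [← hp, sum_mul_lossEst hpos] at this
  refine this.trans (add_le_add_right ?_ _)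
  rw [Finset.sum_eq_single a]
  · have hs : 0 < √(p a) := Real.sqrt_pos.mpr (hpos a)
    have hu : 0 ≤ η * √(p a) * lossEst p c a a / 2 := by have := hnn a; positivity
    rw [sub_zero]
    calc _ ≤ η * √(p a) ^ 3 * lossEst p c a a ^ 2 / 2 :=
          div_le_div_of_nonneg_left (by positivity) two_pos (by linarith)
      _ = ivBound η p c a := by
        have e := Real.sq_sqrt (hpos a).le
        simp only [lossEst, ivBound, if_true]
        generalize √(p a) = s at *
        rw [← e]
        field_simp
  · intro i _ h
    simp [lossEst, h.symm]
  · simp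

/-- Shifting by `c a` turns the estimate of the played arm into `c a * (1 - p a) / p a`, which is
small when `p a` is near `1`. The price is the negative entry `-c a` at all other arms, harmless for
small `η * c a`. -/
theorem le_minObjective_add_shiftedBound {η : ℝ} (hη : 0 < η) (C c : Fin K → ℝ) (a : Fin K)
    (hc : 0 ≤ c a) (hsmall : η * c a ≤ 1 / 4) :
    c a ≤ minObjective η (fun i => C i + lossEst (tsallisDist η C) c a i) - minObjective η C +
      shiftedBound η (tsallisDist η C) c a := by
  have hpos := tsallisDist_pos hη C
  have hle := tsallisDist_le_one η C
  set p := tsallisDist η C with hp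
  have hs1 : ∀ i, √(p i) ≤ 1 := fun i => Real.sqrt_le_one.mpr (hle i)
  have hself : lossEst p c a a - c a = c a * (1 - p a) / p a := by
    have := (hpos a).ne'
    simp only [lossEst, if_true]
    field_simp
  have hself0 : 0 ≤ lossEst p c a a - c a := by
    rw [hself]
    exact div_nonneg (mul_nonneg hc (sub_nonneg.mpr (hle a))) (hpos a).le
  have hother : ∀ i, i ≠ a → lossEst p c a i - c a = - c a := fun i h => by
    simp [lossEst, h.symm]
  -- The subtracted amount is at most half of `1/4`; the resulting denominator `2 * 7/8` is the
  -- source of the factor `4/7` in `shiftedBound`.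
  have hu : ∀ i, i ≠ a → 7 / 8 ≤ 1 + η * √(p i) * (lossEst p c a i - c a) / 2 := by
    intro i h
    rw [hother i h]
    have : η * c a * √(p i) ≤ 1 / 4 * 1 :=
      mul_le_mul hsmall (hs1 i) (Real.sqrt_nonneg _) (by norm_num)
    linarith
  have := inner_le_minObjective_add_stability hη C (lossEst p c a) (c a) fun i => by
    rcases eq_or_ne i a with rfl | h
    · positivity
    · linarith [hu i h]
  rw [← hp, sum_mul_lossEst hpos] at this
  refine this.trans (add_le_add_right ?_ _)
  rw [← Finset.add_sum_erase _ _ (Finset.mem_univ a), shiftedBound,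
    mul_add (η * c a ^ 2), Finset.mul_sum, Finset.mul_sum]
  refine add_le_add ?_ (Finset.sum_le_sum fun i hi => ?_)
  · have hs : 0 < √(p a) := Real.sqrt_pos.mpr (hpos a)
    have hu : 0 ≤ η * √(p a) * (lossEst p c a a - c a) / 2 := by positivity
    calc _ ≤ η * √(p a) ^ 3 * (lossEst p c a a - c a) ^ 2 / 2 :=
          div_le_div_of_nonneg_left (by positivity) two_pos (by linarith)
      _ = _ := by
        have e := Real.sq_sqrt (hpos a).le
        rw [hself]
        generalize √(p a) = s at *
        rw [← e]
        field_simp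
  · have hne := Finset.ne_of_mem_erase hi
    have h7 := hu i hne
    have hs : 0 < √(p i) := Real.sqrt_pos.mpr (hpos i)
    calc _ ≤ η * √(p i) ^ 3 * (lossEst p c a i - c a) ^ 2 / (7 / 4) :=
          div_le_div_of_nonneg_left (by positivity) (by norm_num) (by linarith)
      _ = _ := by rw [hother i hne]; ring

/-- Regret of follow the regularized leader along a sequence of loss estimates. -/
theorem sum_le_cumEst_add {η : ℕ → ℝ} (hη0 : η 0 = 0) (c : ℕ → Fin K → ℝ)
    (I : ℕ → Fin K) (S : ℕ → ℝ) (N : ℕ)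
    (hS : ∀ n ∈ Finset.Icc 1 N, c n (I n) ≤ minObjective (η n) (cumEst η c I n) -
      minObjective (η n) (cumEst η c I (n - 1)) + S n) (k : Fin K) :
    ∑ n ∈ Finset.Icc 1 N, c n (I n) ≤ cumEst η c I N k +
      ∑ n ∈ Finset.Icc 1 N, (S n + (1 / η n - 1 / η (n - 1)) *
        (4 * ∑ i, √(tsallisDist (η n) (cumEst η c I (n - 1)) i) - 4)) := by
  -- Splitting `4 W - 2 = (4 W - 4) + 2` puts `2 / η N` into the invariant. It cancels against the
  -- value of the regularizer at the vertex `k`, and the remaining penalty vanishes at vertices.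
  have main : ∑ n ∈ Finset.Icc 1 N, c n (I n) ≤
      minObjective (η N) (cumEst η c I N) + 2 / η N +
      ∑ n ∈ Finset.Icc 1 N, (S n + (1 / η n - 1 / η (n - 1)) *
        (4 * ∑ i, √(tsallisDist (η n) (cumEst η c I (n - 1)) i) - 4)) := by
    induction N with
    -- With `η 0 = 0` division by zero makes both `1 / η 0` and the initial potential vanish.
    | zero => simp [minObjective, objective, hη0, cumEst]
    | succ n ih =>
      specialize ih fun m hm => hS m (Finset.Icc_subset_Icc_right n.le_succ hm)
      have h1 := hS (n + 1) (Finset.mem_Icc.mpr ⟨by omega, le_rfl⟩)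
      have hp := (tsallisDist_spec (η (n + 1)) (cumEst η c I n)).1
      have h2 : minObjective (η n) (cumEst η c I n) ≤ _ := minObjective_le hp
      rw [objective_of_mem_stdSimplex hp] at h2
      have h3 : minObjective (η (n + 1)) (cumEst η c I n) = _ := objective_of_mem_stdSimplex hp
      rw [Finset.sum_Icc_succ_top (by omega), Finset.sum_Icc_succ_top (by omega)]
      simp only [Nat.add_sub_cancel] at h1 ⊢
      rw [h3] at h1
      generalize ∑ i, √(tsallisDist (η (n + 1)) (cumEst η c I n) i) = W at *
      have e1 : (4 * W - 2) / η n = (4 * W - 4) * (1 / η n) + 2 / η n := by ring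
      have e2 : (4 * W - 2) / η (n + 1) = (4 * W - 4) * (1 / η (n + 1)) + 2 / η (n + 1) := by ring
      rw [e1] at h2
      rw [e2] at h1
      linarith
  have hk : minObjective (η N) (cumEst η c I N) ≤ cumEst η c I N k - 2 / η N := by
    refine (minObjective_le (single_mem_stdSimplex ℝ k)).trans_eq ?_
    rw [objective_of_mem_stdSimplex (single_mem_stdSimplex ℝ k)]
    rw [Finset.sum_eq_single k, Finset.sum_eq_single k]
    · norm_num
    · intro i _ h; simp [h]
    · simp
    · intro i _ h; simp [h]
    · simp
  linarith

end Pathwise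

/-! ### Bounded measurable functions -/

section BddMeasurable

variable {Ω : Type*}

/-- Real functions that are bounded and measurable with respect to `m`. -/
def BddMeasurable (m : MeasurableSpace Ω) (f : Ω → ℝ) : Prop :=
  Measurable[m] f ∧ ∃ M, ∀ ω, |f ω| ≤ M

namespace BddMeasurable

variable {m m' : MeasurableSpace Ω} {f g : Ω → ℝ}

theorem mono (hf : BddMeasurable m f) (h : m ≤ m') : BddMeasurable m' f :=
  ⟨hf.1.mono h le_rfl, hf.2⟩

theorem const (a : ℝ) : BddMeasurable m fun _ => a := ⟨measurable_const, |a|, fun _ => le_rfl⟩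

theorem add (hf : BddMeasurable m f) (hg : BddMeasurable m g) :
    BddMeasurable m fun ω => f ω + g ω := by
  obtain ⟨hf, M, hM⟩ := hf
  obtain ⟨hg, M', hM'⟩ := hg
  exact ⟨hf.add hg, M + M', fun ω => (abs_add_le _ _).trans (add_le_add (hM ω) (hM' ω))⟩

theorem mul (hf : BddMeasurable m f) (hg : BddMeasurable m g) :
    BddMeasurable m fun ω => f ω * g ω := by
  obtain ⟨hf, M, hM⟩ := hf
  obtain ⟨hg, M', hM'⟩ := hg
  refine ⟨hf.mul hg, M * M', fun ω => ?_⟩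
  rw [abs_mul]
  exact mul_le_mul (hM ω) (hM' ω) (abs_nonneg _) ((abs_nonneg _).trans (hM ω))

theorem const_mul (a : ℝ) (hf : BddMeasurable m f) : BddMeasurable m fun ω => a * f ω :=
  (const a).mul hf

theorem sub (hf : BddMeasurable m f) (hg : BddMeasurable m g) :
    BddMeasurable m fun ω => f ω - g ω := by
  simpa [sub_eq_add_neg] using hf.add (hg.const_mul (-1))

theorem pow (hf : BddMeasurable m f) (k : ℕ) : BddMeasurable m fun ω => f ω ^ k := by
  induction k with
  | zero => simpa using const 1
  | succ k ih => simpa [pow_succ] using ih.mul hf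

theorem sum {ι : Type*} (s : Finset ι) {F : ι → Ω → ℝ} (h : ∀ i ∈ s, BddMeasurable m (F i)) :
    BddMeasurable m fun ω => ∑ i ∈ s, F i ω := by
  classical
  induction s using Finset.induction_on with
  | empty => simpa using const 0
  | insert a s ha ih =>
    simp only [Finset.sum_insert ha]
    exact (h a (Finset.mem_insert_self a s)).add
      (ih fun i hi => h i (Finset.mem_insert_of_mem hi))

theorem prod {ι : Type*} (s : Finset ι) {F : ι → Ω → ℝ} (h : ∀ i ∈ s, BddMeasurable m (F i)) :
    BddMeasurable m fun ω => ∏ i ∈ s, F i ω := by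
  classical
  induction s using Finset.induction_on with
  | empty => simpa using const 1
  | insert a s ha ih =>
    simp only [Finset.prod_insert ha]
    exact (h a (Finset.mem_insert_self a s)).mul
      (ih fun i hi => h i (Finset.mem_insert_of_mem hi))

theorem of_mem_Icc {a : ℝ} (hf : Measurable[m] f) (h : ∀ ω, f ω ∈ Set.Icc 0 a) :
    BddMeasurable m f := ⟨hf, a, fun ω => (abs_of_nonneg (h ω).1).trans_le (h ω).2⟩

theorem indicator_eq {α : Type*} [MeasurableSpace α] [MeasurableSingletonClass α]
    [DecidableEq α] {J : Ω → α} (hJ : Measurable[m] J) (a : α) :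
    BddMeasurable m fun ω => if J ω = a then (1 : ℝ) else 0 := by
  refine ⟨Measurable.ite (hJ (measurableSet_singleton a)) measurable_const measurable_const,
    1, fun ω => ?_⟩
  dsimp only
  split_ifs <;> simp

theorem integrable {m₀ : MeasurableSpace Ω} {μ : Measure Ω} [IsFiniteMeasure μ]
    (hf : BddMeasurable m₀ f) : Integrable f μ := by
  obtain ⟨hf, M, hM⟩ := hf
  exact Integrable.of_bound hf.aestronglyMeasurable M (Filter.Eventually.of_forall hM)

end BddMeasurable

end BddMeasurable

/-! ### Expected regret over blocks -/

section BlockGame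

variable {K : ℕ} {Ω : Type*}

theorem eq_sum_mul_indicator (G : Fin K → ℝ) (a : Fin K) :
    G a = ∑ i, G i * (if a = i then 1 else 0) := by simp

variable [NeZero K]

theorem measurable_tsallisDist_comp {m : MeasurableSpace Ω} {a : ℝ} (ha : 0 < a)
    {f : Ω → Fin K → ℝ} (hf : ∀ i, Measurable[m] fun ω => f ω i) (i : Fin K) :
    Measurable[m] fun ω => tsallisDist a (f ω) i :=
  ((continuous_apply i).comp (continuous_tsallisDist ha)).measurable.comp (measurable_pi_iff.mpr hf)

theorem measurable_cumEst_comp {m : MeasurableSpace Ω} {η : ℕ → ℝ} {c : ℕ → Ω → Fin K → ℝ}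
    (hη : ∀ n, 1 ≤ n → 0 < η n)
    {J : ℕ → Ω → Fin K} (k : ℕ) (hc : ∀ n, 1 ≤ n → n ≤ k → ∀ i, Measurable[m] fun ω => c n ω i)
    (hJ : ∀ n, 1 ≤ n → n ≤ k → Measurable[m] (J n)) (i : Fin K) :
    Measurable[m] fun ω => cumEst η (fun n => c n ω) (fun n => J n ω) k i := by
  induction k generalizing i with
  | zero => exact measurable_const
  | succ k ih =>
    have ih := ih (fun n h1 h2 => hc n h1 (h2.trans k.le_succ))
      (fun n h1 h2 => hJ n h1 (h2.trans k.le_succ))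
    refine (ih i).add (Measurable.ite ?_ ?_ measurable_const)
    · exact hJ (k + 1) (by omega) le_rfl (measurableSet_singleton i)
    · exact (hc (k + 1) (by omega) le_rfl i).div
        (measurable_tsallisDist_comp (hη (k + 1) (by omega)) ih i)

/-- The distribution from which the arm of block `n` is drawn when the block losses are `c`. -/
noncomputable def armDist (η : ℕ → ℝ) (c : ℕ → Ω → Fin K → ℝ) (I : ℕ → Ω → Fin K) (n : ℕ) (ω : Ω) :
    Fin K → ℝ :=
  tsallisDist (η n) (cumEst η (fun m => c m ω) (fun m => I m ω) (n - 1))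

/-- A game of `N` blocks with block losses `c n ω i ∈ [0, b n]` in which the arm `I n` is drawn
from `armDist η c I n`, given the information `ℱ n`. -/
structure IsBlockGame [mΩ : MeasurableSpace Ω] (μ : Measure Ω) (η : ℕ → ℝ)
    (ℱ : ℕ → MeasurableSpace Ω) (c : ℕ → Ω → Fin K → ℝ) (I : ℕ → Ω → Fin K) (b : ℕ → ℝ)
    (N : ℕ) : Prop where
  rate_zero : η 0 = 0
  rate_pos : ∀ n, 1 ≤ n → 0 < η n
  le : ∀ n, ℱ n ≤ mΩ
  measurable_loss : ∀ n m i, Measurable[ℱ n] fun ω => c m ω i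
  loss_mem : ∀ n ω i, c n ω i ∈ Set.Icc 0 (b n)
  measurable_arm : ∀ n, 1 ≤ n → Measurable (I n)
  measurable_past_arm : ∀ n m, 1 ≤ m → m < n → Measurable[ℱ n] (I m)
  law : ∀ n, 1 ≤ n → n ≤ N → ∀ i,
    μ[fun ω => if I n ω = i then (1 : ℝ) else 0 | ℱ n] =ᵐ[μ] fun ω => armDist η c I n ω i

namespace IsBlockGame

variable [mΩ : MeasurableSpace Ω] {μ : Measure Ω} {η : ℕ → ℝ}
    {ℱ : ℕ → MeasurableSpace Ω} {c : ℕ → Ω → Fin K → ℝ} {I : ℕ → Ω → Fin K} {b : ℕ → ℝ} {N : ℕ}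

variable (hG : IsBlockGame μ η ℱ c I b N)
include hG

theorem measurable_cumEst {n m : ℕ} (h : m < n) (i : Fin K) :
    Measurable[ℱ n] fun ω => cumEst η (fun m => c m ω) (fun m => I m ω) m i :=
  measurable_cumEst_comp hG.rate_pos m (fun k _ _ => hG.measurable_loss n k)
    (fun k h1 h2 => hG.measurable_past_arm n k h1 (h2.trans_lt h)) i

theorem armDist_pos {n : ℕ} (hn : 1 ≤ n) (ω : Ω) (i : Fin K) : 0 < armDist η c I n ω i :=
  tsallisDist_pos (hG.rate_pos n hn) _ i

theorem bddMeasurable_armDist {n : ℕ} (hn : 1 ≤ n) (i : Fin K) :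
    BddMeasurable (ℱ n) fun ω => armDist η c I n ω i :=
  .of_mem_Icc (measurable_tsallisDist_comp (hG.rate_pos n hn)
    (hG.measurable_cumEst (by omega)) i)
    fun _ => ⟨tsallisDist_nonneg _ _ _, tsallisDist_le_one _ _ _⟩

theorem bddMeasurable_sqrt_armDist {n : ℕ} (hn : 1 ≤ n) (i : Fin K) :
    BddMeasurable (ℱ n) fun ω => √(armDist η c I n ω i) :=
  .of_mem_Icc (hG.bddMeasurable_armDist hn i).1.sqrt
    fun _ => ⟨Real.sqrt_nonneg _, Real.sqrt_le_one.mpr (tsallisDist_le_one _ _ _)⟩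

-- Bounded estimates keep the next probabilities away from zero, which in turn bounds the next
-- importance weight by the square of the bound on `1 / √p`.
theorem exists_cumEst_le (n : ℕ) : ∃ M, ∀ ω i,
    cumEst η (fun m => c m ω) (fun m => I m ω) n i ∈ Set.Icc 0 M := by
  induction n with
  | zero => exact ⟨0, fun ω i => ⟨le_rfl, le_rfl⟩⟩
  | succ n ih =>
    obtain ⟨M, hM⟩ := ih
    have hη := hG.rate_pos (n + 1) (by omega)
    refine ⟨M + b (n + 1) * (√K + η (n + 1) / 2 * M) ^ 2, fun ω i => ?_⟩
    have hc := hG.loss_mem (n + 1) ω i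
    set C := cumEst η (fun m => c m ω) (fun m => I m ω) n with hC
    have hp := tsallisDist_pos hη C i
    have h1 : (√(tsallisDist (η (n + 1)) C i))⁻¹ ≤ √K + η (n + 1) / 2 * M :=
      (inv_sqrt_tsallisDist_le hη (fun j => (hM ω j).1) i).trans (by have := (hM ω i).2; gcongr)
    have h2 : 0 ≤ c (n + 1) ω i / tsallisDist (η (n + 1)) C i := div_nonneg hc.1 hp.le
    have h3 : c (n + 1) ω i / tsallisDist (η (n + 1)) C i ≤
        b (n + 1) * (√K + η (n + 1) / 2 * M) ^ 2 := by
      rw [div_eq_mul_inv]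
      refine mul_le_mul hc.2 ?_ (by positivity) (hc.1.trans hc.2)
      rw [← Real.sq_sqrt hp.le, ← inv_pow]
      exact pow_le_pow_left₀ (by positivity) h1 2
    have h4 := hM ω i
    show C i + _ ∈ _
    simp only
    split_ifs
    · exact ⟨add_nonneg h4.1 h2, add_le_add h4.2 h3⟩
    · exact ⟨by linarith [h4.1], by linarith [h4.2]⟩

theorem bddMeasurable_inv_sqrt_armDist {n : ℕ} (hn : 1 ≤ n) (i : Fin K) :
    BddMeasurable (ℱ n) fun ω => (√(armDist η c I n ω i))⁻¹ := by
  obtain ⟨M, hM⟩ := hG.exists_cumEst_le (n - 1)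
  have hη := hG.rate_pos n hn
  refine .of_mem_Icc (a := √K + η n / 2 * M) (hG.bddMeasurable_sqrt_armDist hn i).1.inv
    fun ω => ⟨by positivity, ?_⟩
  exact (inv_sqrt_tsallisDist_le hη (fun j => (hM ω j).1) i).trans
    (by have := (hM ω i).2; gcongr)

theorem bddMeasurable_loss (n m : ℕ) (i : Fin K) : BddMeasurable (ℱ n) fun ω => c m ω i :=
  .of_mem_Icc (hG.measurable_loss n m i) fun ω => hG.loss_mem m ω i

theorem bddMeasurable_loss_div {n : ℕ} (hn : 1 ≤ n) (i : Fin K) :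
    BddMeasurable (ℱ n) fun ω => c n ω i / armDist η c I n ω i := by
  convert (hG.bddMeasurable_loss n n i).mul ((hG.bddMeasurable_inv_sqrt_armDist hn i).pow 2)
    using 2 with ω
  rw [inv_pow, Real.sq_sqrt (hG.armDist_pos hn ω i).le, div_eq_mul_inv]

theorem bddMeasurable_ivBound {n : ℕ} (hn : 1 ≤ n) (i : Fin K) :
    BddMeasurable (ℱ n) fun ω => ivBound (η n) (armDist η c I n ω) (c n ω) i := by
  simp only [ivBound, div_eq_mul_inv _ (√_)]
  exact (((hG.bddMeasurable_loss n n i).pow 2).const_mul _).mul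
    (hG.bddMeasurable_inv_sqrt_armDist hn i)

theorem bddMeasurable_shiftedBound {n : ℕ} (hn : 1 ≤ n) (i : Fin K) :
    BddMeasurable (ℱ n) fun ω => shiftedBound (η n) (armDist η c I n ω) (c n ω) i := by
  simp only [shiftedBound, div_eq_mul_inv _ (_ * √_), mul_inv]
  exact (((hG.bddMeasurable_loss n n i).pow 2).const_mul _).mul
    (((((BddMeasurable.const 1).sub (hG.bddMeasurable_armDist hn i)).pow 2).mul
      ((hG.bddMeasurable_inv_sqrt_armDist hn i).const_mul _)).add
      ((BddMeasurable.sum _ fun j _ => (hG.bddMeasurable_sqrt_armDist hn j).pow 3).const_mul _))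

theorem bddMeasurable_comp_arm {n : ℕ} (hn : 1 ≤ n) {G : Ω → Fin K → ℝ}
    (hX : ∀ i, BddMeasurable (ℱ n) fun ω => G ω i) : BddMeasurable mΩ fun ω => G ω (I n ω) := by
  simp_rw [fun ω => eq_sum_mul_indicator (G ω) (I n ω)]
  exact .sum _ fun i _ => ((hX i).mono (hG.le n)).mul (.indicator_eq (hG.measurable_arm n hn) i)

variable [IsProbabilityMeasure μ]

/-- The law of the draw enters the expectations here: `X` is known before the draw, so it can be
pulled out of the conditional expectation. -/
theorem integral_mul_indicator {n : ℕ} (hn : 1 ≤ n) (hN : n ≤ N) (i : Fin K) {X : Ω → ℝ}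
    (hX : BddMeasurable (ℱ n) X) :
    ∫ ω, X ω * (if I n ω = i then 1 else 0) ∂μ = ∫ ω, X ω * armDist η c I n ω i ∂μ := by
  have hint : Integrable (fun ω => if I n ω = i then (1 : ℝ) else 0) μ :=
    (BddMeasurable.indicator_eq (hG.measurable_arm n hn) i).integrable
  obtain ⟨hXm, M, hM⟩ := hX
  have h := condExp_stronglyMeasurable_mul_of_bound (hG.le n) hXm.stronglyMeasurable hint M
    (Filter.Eventually.of_forall hM)
  calc _ = ∫ ω, (μ[X * (fun ω => if I n ω = i then (1 : ℝ) else 0) | ℱ n]) ω ∂μ :=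
        (integral_condExp (hG.le n)).symm
    _ = _ := integral_congr_ae <| by
        filter_upwards [h, hG.law n hn hN i] with ω h1 h2
        rw [h1, Pi.mul_apply, h2]

theorem integral_comp_arm {n : ℕ} (hn : 1 ≤ n) (hN : n ≤ N) {G : Ω → Fin K → ℝ}
    (hX : ∀ i, BddMeasurable (ℱ n) fun ω => G ω i) :
    ∫ ω, G ω (I n ω) ∂μ = ∫ ω, ∑ i, armDist η c I n ω i * G ω i ∂μ := by
  simp_rw [fun ω => eq_sum_mul_indicator (G ω) (I n ω)]
  rw [integral_finsetSum, integral_finsetSum]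
  · refine Finset.sum_congr rfl fun i _ => ?_
    rw [hG.integral_mul_indicator hn hN i (hX i)]
    simp_rw [mul_comm]
  · exact fun i _ => (((hG.bddMeasurable_armDist hn i).mul (hX i)).mono (hG.le n)).integrable
  · exact fun i _ => (((hX i).mono (hG.le n)).mul
      (.indicator_eq (hG.measurable_arm n hn) i)).integrable

theorem measureReal_arm_eq {n : ℕ} (hn : 1 ≤ n) (hN : n ≤ N) (i : Fin K) :
    μ.real {ω | I n ω = i} = ∫ ω, armDist η c I n ω i ∂μ := by
  have h := hG.integral_mul_indicator hn hN i (BddMeasurable.const 1)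
  simp only [one_mul] at h
  rw [← h]
  rw [show (fun ω => if I n ω = i then (1 : ℝ) else 0) = Set.indicator (I n ⁻¹' {i}) 1 from by
    ext; simp [Set.indicator]]
  exact (integral_indicator_one (hG.measurable_arm n hn (measurableSet_singleton i))).symm

theorem measureReal_arm_ne {n : ℕ} (hn : 1 ≤ n) (hN : n ≤ N) (k : Fin K) :
    μ.real {ω | I n ω ≠ k} = ∑ i ∈ Finset.univ.erase k, ∫ ω, armDist η c I n ω i ∂μ := by
  rw [← Finset.sum_congr rfl fun i _ => hG.measureReal_arm_eq hn hN i]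
  rw [show {ω | I n ω ≠ k} = ⋃ i ∈ Finset.univ.erase k, {ω | I n ω = i} by ext; simp]
  refine measureReal_biUnion_finset (fun i _ j _ hij => ?_)
    fun i _ => hG.measurable_arm n hn (measurableSet_singleton i)
  exact Set.disjoint_left.mpr fun ω h1 h2 => hij (h1.symm.trans h2)

/-- The loss estimates are unbiased. -/
theorem integral_cumEst (k : Fin K) (n : ℕ) (hN : n ≤ N) :
    Integrable (fun ω => cumEst η (fun m => c m ω) (fun m => I m ω) n k) μ ∧
    ∫ ω, cumEst η (fun m => c m ω) (fun m => I m ω) n k ∂μ =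
      ∑ m ∈ Finset.Icc 1 n, ∫ ω, c m ω k ∂μ := by
  induction n with
  | zero => simp [cumEst]
  | succ n ih =>
    obtain ⟨h1, h2⟩ := ih (by omega)
    have e : ∀ ω, cumEst η (fun m => c m ω) (fun m => I m ω) (n + 1) k =
        cumEst η (fun m => c m ω) (fun m => I m ω) n k +
          c (n + 1) ω k / armDist η c I (n + 1) ω k * (if I (n + 1) ω = k then 1 else 0) := by
      intro ω
      simp [cumEst, armDist]
    have hb := hG.bddMeasurable_loss_div (n := n + 1) (by omega) k
    have h3 := ((hb.mono (hG.le _)).mul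
      (.indicator_eq (hG.measurable_arm (n + 1) (by omega)) k)).integrable (μ := μ)
    simp_rw [e]
    refine ⟨h1.add h3, ?_⟩
    rw [integral_add h1 h3, h2, Finset.sum_Icc_succ_top (by omega),
      hG.integral_mul_indicator (by omega) hN k hb]
    congr 1
    refine integral_congr_ae (Filter.Eventually.of_forall fun ω => ?_)
    exact div_mul_cancel₀ _ (hG.armDist_pos (by omega) ω k).ne'

/-- Expected regret against the arm `k`, for stability terms `G`. -/
theorem expected_regret_le {G : ℕ → Ω → Fin K → ℝ}
    (hGm : ∀ n, 1 ≤ n → ∀ i, BddMeasurable (ℱ n) fun ω => G n ω i)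
    (hS : ∀ n, 1 ≤ n → n ≤ N → ∀ ω, c n ω (I n ω) ≤
      minObjective (η n) (cumEst η (fun m => c m ω) (fun m => I m ω) n) -
      minObjective (η n) (cumEst η (fun m => c m ω) (fun m => I m ω) (n - 1)) + G n ω (I n ω))
    (k : Fin K) :
    ∫ ω, ∑ n ∈ Finset.Icc 1 N, c n ω (I n ω) ∂μ - ∑ n ∈ Finset.Icc 1 N, ∫ ω, c n ω k ∂μ ≤
      ∑ n ∈ Finset.Icc 1 N, ∫ ω, (∑ i, armDist η c I n ω i * G n ω i +
        (1 / η n - 1 / η (n - 1)) * (4 * ∑ i, √(armDist η c I n ω i) - 4)) ∂μ := by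
  obtain ⟨hi, he⟩ := hG.integral_cumEst k N le_rfl
  have hc : ∀ n ∈ Finset.Icc 1 N, BddMeasurable mΩ fun ω => c n ω (I n ω) := fun n hn =>
    hG.bddMeasurable_comp_arm (Finset.mem_Icc.mp hn).1 fun i => hG.bddMeasurable_loss n n i
  have hg : ∀ n ∈ Finset.Icc 1 N, BddMeasurable mΩ fun ω => G n ω (I n ω) := fun n hn =>
    hG.bddMeasurable_comp_arm (Finset.mem_Icc.mp hn).1 (hGm n (Finset.mem_Icc.mp hn).1)
  have hp : ∀ n ∈ Finset.Icc 1 N, BddMeasurable mΩ fun ω => (1 / η n - 1 / η (n - 1)) *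
      (4 * ∑ i, √(armDist η c I n ω i) - 4) := fun n hn =>
    (((BddMeasurable.sum _ fun i _ => hG.bddMeasurable_sqrt_armDist (Finset.mem_Icc.mp hn).1
      i).const_mul 4).sub (.const 4)).const_mul _ |>.mono (hG.le n)
  have hpG : ∀ n ∈ Finset.Icc 1 N, BddMeasurable mΩ fun ω =>
      ∑ i, armDist η c I n ω i * G n ω i := fun n hn =>
    (BddMeasurable.sum _ fun i _ => (hG.bddMeasurable_armDist (Finset.mem_Icc.mp hn).1 i).mul
      (hGm n (Finset.mem_Icc.mp hn).1 i)).mono (hG.le n)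
  have hsum : BddMeasurable mΩ fun ω => ∑ n ∈ Finset.Icc 1 N, (G n ω (I n ω) +
      (1 / η n - 1 / η (n - 1)) * (4 * ∑ i, √(armDist η c I n ω i) - 4)) :=
    .sum _ fun n hn => (hg n hn).add (hp n hn)
  have h1 : ∫ ω, ∑ n ∈ Finset.Icc 1 N, c n ω (I n ω) ∂μ ≤
      ∫ ω, (cumEst η (fun m => c m ω) (fun m => I m ω) N k +
        ∑ n ∈ Finset.Icc 1 N, (G n ω (I n ω) +
      (1 / η n - 1 / η (n - 1)) * (4 * ∑ i, √(armDist η c I n ω i) - 4))) ∂μ := by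
    refine integral_mono (BddMeasurable.sum _ hc).integrable (hi.add hsum.integrable) fun ω => ?_
    exact sum_le_cumEst_add hG.rate_zero (fun m => c m ω) (fun m => I m ω)
      (fun n => G n ω (I n ω)) N
      (fun n hn => hS n (Finset.mem_Icc.mp hn).1 (Finset.mem_Icc.mp hn).2 ω) k
  rw [integral_add hi hsum.integrable, he,
    integral_finsetSum _ fun n hn => ((hg n hn).add (hp n hn)).integrable] at h1
  have h2 : ∀ n ∈ Finset.Icc 1 N, ∫ ω, (G n ω (I n ω) +
      (1 / η n - 1 / η (n - 1)) * (4 * ∑ i, √(armDist η c I n ω i) - 4)) ∂μ =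
      ∫ ω, (∑ i, armDist η c I n ω i * G n ω i +
        (1 / η n - 1 / η (n - 1)) * (4 * ∑ i, √(armDist η c I n ω i) - 4)) ∂μ := by
    intro n hn
    rw [integral_add (hg n hn).integrable (hp n hn).integrable,
      integral_add (hpG n hn).integrable (hp n hn).integrable,
      hG.integral_comp_arm (Finset.mem_Icc.mp hn).1 (Finset.mem_Icc.mp hn).2
        (hGm n (Finset.mem_Icc.mp hn).1)]
  rw [Finset.sum_congr rfl h2] at h1
  linarith

end IsBlockGame

end BlockGame

/-! ### Losses that are unpredictable from the past -/

section Unpredictable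

variable {K : ℕ} [NeZero K]

theorem cumEst_congr (η : ℕ → ℝ) {c c' : ℕ → Fin K → ℝ} {I I' : ℕ → Fin K} {n : ℕ}
    (hc : ∀ m, 1 ≤ m → m ≤ n → c m = c' m) (hI : ∀ m, 1 ≤ m → m ≤ n → I m = I' m) :
    cumEst η c I n = cumEst η c' I' n := by
  induction n with
  | zero => rfl
  | succ n ih =>
    have ih := ih (fun m h1 h2 => hc m h1 (h2.trans n.le_succ))
      (fun m h1 h2 => hI m h1 (h2.trans n.le_succ))
    ext i
    simp only [cumEst, ih, hc (n + 1) (by omega) le_rfl, hI (n + 1) (by omega) le_rfl]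

namespace IsBlockGame

variable {Ω : Type*} {𝒢 : MeasurableSpace Ω} [mΩ : MeasurableSpace Ω] {μ : Measure Ω}
    [IsProbabilityMeasure μ] {η : ℕ → ℝ} {ℱ : ℕ → MeasurableSpace Ω} {c : ℕ → Ω → Fin K → ℝ} {I : ℕ → Ω → Fin K}
    {b : ℕ → ℝ} {N : ℕ}

/-- Conditioning on the first arms does not change the mean of a loss difference that is
unpredictable from the past losses. -/
theorem integral_path_mul (hG : IsBlockGame μ η ℱ c I b N) (h𝒢 : 𝒢 ≤ mΩ)
    (h𝒢ℱ : ∀ n, 𝒢 ≤ ℱ n) {n : ℕ} (hN : n ≤ N)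
    (hc : ∀ m, 1 ≤ m → m < n → ∀ i, Measurable[𝒢] fun ω => c m ω i) {g : Ω → ℝ}
    (hg : ∀ n, BddMeasurable (ℱ n) g) {Δ : ℝ} (hΔ : μ[g | 𝒢] =ᵐ[μ] fun _ => Δ) (w : ℕ → Fin K)
    (m : ℕ) (hm : m ≤ n) {Y : Ω → ℝ} (hY : BddMeasurable 𝒢 Y) :
    ∫ ω, (∏ k ∈ Finset.Icc 1 m, if I k ω = w k then (1 : ℝ) else 0) * Y ω * g ω ∂μ =
      Δ * ∫ ω, (∏ k ∈ Finset.Icc 1 m, if I k ω = w k then (1 : ℝ) else 0) * Y ω ∂μ := by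
  induction m generalizing Y with
  | zero =>
    have hgi : Integrable g μ := ((hg 0).mono (hG.le 0)).integrable
    simp only [Finset.Icc_eq_empty_of_lt one_pos, Finset.prod_empty, one_mul]
    obtain ⟨hYm, M, hM⟩ := hY
    have h := condExp_stronglyMeasurable_mul_of_bound h𝒢 hYm.stronglyMeasurable hgi M
      (Filter.Eventually.of_forall hM)
    calc _ = ∫ ω, (μ[Y * g | 𝒢]) ω ∂μ := (integral_condExp h𝒢).symm
      _ = ∫ ω, Δ * Y ω ∂μ := integral_congr_ae <| by
          filter_upwards [h, hΔ] with ω h1 h2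
          rw [h1, Pi.mul_apply, h2, mul_comm]
      _ = _ := integral_const_mul _ _
  | succ m ih =>
    have hA : ∀ ω, (∏ k ∈ Finset.Icc 1 (m + 1), if I k ω = w k then (1 : ℝ) else 0) =
        (∏ k ∈ Finset.Icc 1 m, if I k ω = w k then (1 : ℝ) else 0) *
          (if I (m + 1) ω = w (m + 1) then 1 else 0) := by
      exact fun ω => Finset.prod_Icc_succ_top (by omega) _
    have hAm : BddMeasurable (ℱ (m + 1))
        fun ω => ∏ k ∈ Finset.Icc 1 m, if I k ω = w k then (1 : ℝ) else 0 := by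
      refine .prod _ fun k hk => .indicator_eq (hG.measurable_past_arm (m + 1) k ?_ ?_) _
      · exact (Finset.mem_Icc.mp hk).1
      · exact Nat.lt_succ_of_le (Finset.mem_Icc.mp hk).2
    -- On the event that the first `m` arms follow `w`, the probability of the next arm depends only
    -- on the losses of the first `m < n` blocks. Thus it is `𝒢`-measurable and can be absorbed into
    -- `Y`.
    set q : Ω → ℝ := fun ω =>
      tsallisDist (η (m + 1)) (cumEst η (fun k => c k ω) w m) (w (m + 1)) with hq
    have hqm : BddMeasurable 𝒢 q := .of_mem_Icc
      (measurable_tsallisDist_comp (hG.rate_pos _ (by omega))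
        (measurable_cumEst_comp (J := fun k _ => w k) hG.rate_pos m
          (fun k h1 h2 => hc k h1 (by omega)) fun _ _ _ => measurable_const) _)
      fun _ => ⟨tsallisDist_nonneg _ _ _, tsallisDist_le_one _ _ _⟩
    have hAq : ∀ ω, (∏ k ∈ Finset.Icc 1 m, if I k ω = w k then (1 : ℝ) else 0) *
        armDist η c I (m + 1) ω (w (m + 1)) =
        (∏ k ∈ Finset.Icc 1 m, if I k ω = w k then (1 : ℝ) else 0) * q ω := by
      intro ω
      by_cases h : ∀ k ∈ Finset.Icc 1 m, I k ω = w k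
      · rw [hq, armDist, Nat.add_sub_cancel, cumEst_congr η (fun _ _ _ => rfl)
          fun k h1 h2 => h k (Finset.mem_Icc.mpr ⟨h1, h2⟩)]
      · push Not at h
        obtain ⟨k, hk, hne⟩ := h
        rw [Finset.prod_eq_zero hk (if_neg hne), zero_mul, zero_mul]
    have hYF := hY.mono (h𝒢ℱ (m + 1))
    have e1 := hG.integral_mul_indicator (n := m + 1) (by omega) (by omega) (w (m + 1))
      ((hAm.mul hYF).mul (hg (m + 1)))
    have e2 := hG.integral_mul_indicator (n := m + 1) (by omega) (by omega) (w (m + 1))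
      (hAm.mul hYF)
    have e3 := ih (by omega) (hY.mul hqm)
    calc _ = _ := by
          refine Eq.trans (integral_congr_ae (.of_forall fun ω => ?_)) e1
          simp only [hA]; ring
      _ = _ := by
          refine Eq.trans (integral_congr_ae (.of_forall fun ω => ?_)) e3
          have := hAq ω
          dsimp only
          linear_combination Y ω * g ω * this
      _ = _ := by
          congr 1
          calc _ = _ := by
                refine Eq.trans (integral_congr_ae (.of_forall fun ω => ?_)) e2.symm
                have := hAq ω
                dsimp only
                linear_combination - Y ω * this
            _ = _ := integral_congr_ae (.of_forall fun ω => by simp only [hA]; ring)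

/-- Decompose according to the path of the first `n` arms and apply `integral_path_mul` to each path
ending in `i`. -/
theorem integral_indicator_arm_mul (hG : IsBlockGame μ η ℱ c I b N)
    (h𝒢 : 𝒢 ≤ mΩ) (h𝒢ℱ : ∀ n, 𝒢 ≤ ℱ n) {n : ℕ} (hn : 1 ≤ n) (hN : n ≤ N)
    (hc : ∀ m, 1 ≤ m → m < n → ∀ i, Measurable[𝒢] fun ω => c m ω i) {g : Ω → ℝ}
    (hg : ∀ n, BddMeasurable (ℱ n) g) {Δ : ℝ} (hΔ : μ[g | 𝒢] =ᵐ[μ] fun _ => Δ) (i : Fin K) :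
    ∫ ω, (if I n ω = i then 1 else 0) * g ω ∂μ = Δ * ∫ ω, armDist η c I n ω i ∂μ := by
  -- Blocks are numbered from `1` and `Fin n` from `0`; the values outside the path are irrelevant.
  set w : (Fin n → Fin K) → ℕ → Fin K := fun v k => if h : k - 1 < n then v ⟨k - 1, h⟩ else 0
    with hw
  set A : (Fin n → Fin K) → Ω → ℝ :=
    fun v ω => ∏ k ∈ Finset.Icc 1 n, if I k ω = w v k then (1 : ℝ) else 0 with hA
  set Y : (Fin n → Fin K) → ℝ := fun v => if w v n = i then 1 else 0 with hY
  have hAv : ∀ v ω, A v ω = if (fun k : Fin n => I (k + 1) ω) = v then 1 else 0 := by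
    intro v ω
    split_ifs with h
    · refine Finset.prod_eq_one fun k hk => if_pos ?_
      obtain ⟨h1, h2⟩ := Finset.mem_Icc.mp hk
      have : k - 1 < n := by omega
      simp only [hw, this, dif_pos, ← h, Nat.sub_add_cancel h1]
    · obtain ⟨k, hk⟩ := Function.ne_iff.mp h
      refine Finset.prod_eq_zero (i := (k : ℕ) + 1) (Finset.mem_Icc.mpr ⟨by omega, by omega⟩)
        (if_neg ?_)
      simpa [hw] using hk
  have hsum : ∀ ω, (if I n ω = i then (1 : ℝ) else 0) = ∑ v, A v ω * Y v := by
    intro ω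
    simp only [hAv, ite_mul, one_mul, zero_mul, Finset.sum_ite_eq, Finset.mem_univ, if_true, hY, hw]
    have : n - 1 < n := by omega
    simp only [this, dif_pos, Nat.sub_add_cancel hn]
  have hAm : ∀ v, BddMeasurable mΩ (A v) := by
    intro v
    have : A v = fun ω => if (fun k : Fin n => I (k + 1) ω) = v then (1 : ℝ) else 0 :=
      funext (hAv v)
    rw [this]
    exact .indicator_eq (measurable_pi_iff.mpr fun k : Fin n =>
      hG.measurable_arm (k + 1) (by omega)) v
  have hgm : BddMeasurable mΩ g := (hg 0).mono (hG.le 0)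
  have h1 : ∫ ω, (if I n ω = i then 1 else 0) * g ω ∂μ =
      Δ * ∫ ω, (if I n ω = i then 1 else 0) ∂μ := by
    simp_rw [hsum, Finset.sum_mul]
    rw [integral_finsetSum _ fun v _ => (((hAm v).mul (.const (Y v))).mul hgm).integrable,
      integral_finsetSum _ fun v _ => ((hAm v).mul (.const (Y v))).integrable, Finset.mul_sum]
    exact Finset.sum_congr rfl fun v _ =>
      hG.integral_path_mul h𝒢 h𝒢ℱ hN hc hg hΔ (w v) n le_rfl (.const (Y v))
  have h2 := hG.integral_mul_indicator hn hN i (BddMeasurable.const 1)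
  simp only [one_mul] at h2
  rw [h1, h2]

end IsBlockGame

end Unpredictable

/-! ### Rounds and blocks -/

section Blocks

variable {B : ℕ → ℕ}

theorem roundsUpTo_succ (B : ℕ → ℕ) (n : ℕ) : roundsUpTo B (n + 1) = roundsUpTo B n + B (n + 1) :=
  Finset.sum_Icc_succ_top (by omega) _

theorem strictMono_roundsUpTo (hB : ∀ n, 1 ≤ B n) : StrictMono (roundsUpTo B) :=
  strictMono_nat_of_lt_succ fun n => by have := hB (n + 1); rw [roundsUpTo_succ]; omega

theorem le_roundsUpTo_numBlocks (hB : ∀ n, 1 ≤ B n) (t : ℕ) : t ≤ roundsUpTo B (numBlocks B t) :=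
  Nat.sInf_mem (s := {N | t ≤ roundsUpTo B N}) ⟨t, (strictMono_roundsUpTo hB).id_le t⟩

theorem numBlocks_le {t n : ℕ} (h : t ≤ roundsUpTo B n) : numBlocks B t ≤ n := Nat.sInf_le h

theorem roundsUpTo_lt {t n : ℕ} (h : n < numBlocks B t) : roundsUpTo B n < t :=
  not_le.mp fun h' => absurd (numBlocks_le h') (not_le.mpr h)

theorem numBlocks_eq_iff (hB : ∀ n, 1 ≤ B n) {t n : ℕ} (hn : 1 ≤ n) :
    numBlocks B t = n ↔ roundsUpTo B (n - 1) < t ∧ t ≤ roundsUpTo B n := by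
  constructor
  · rintro rfl
    exact ⟨roundsUpTo_lt (by omega), le_roundsUpTo_numBlocks hB t⟩
  · rintro ⟨h1, h2⟩
    refine le_antisymm (numBlocks_le h2) ?_
    by_contra h
    have := (strictMono_roundsUpTo hB).monotone (show numBlocks B t ≤ n - 1 by omega)
    have := le_roundsUpTo_numBlocks hB t
    omega

/-- The rounds of block `n` that are played in a game of `T` rounds. -/
noncomputable def playedBlock (B : ℕ → ℕ) (T n : ℕ) : Finset ℕ :=
  {t ∈ Finset.Icc 1 T | numBlocks B t = n}

theorem mem_playedBlock {T n t : ℕ} :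
    t ∈ playedBlock B T n ↔ (1 ≤ t ∧ t ≤ T) ∧ numBlocks B t = n := by
  simp [playedBlock]

theorem playedBlock_eq_Ioc (hB : ∀ n, 1 ≤ B n) (T : ℕ) {n : ℕ} (hn : 1 ≤ n) :
    playedBlock B T n = Finset.Ioc (roundsUpTo B (n - 1)) (min (roundsUpTo B n) T) := by
  ext t
  rw [mem_playedBlock, numBlocks_eq_iff hB hn, Finset.mem_Ioc]
  omega

theorem roundsUpTo_eq_pred_add {n : ℕ} (hn : 1 ≤ n) :
    roundsUpTo B n = roundsUpTo B (n - 1) + B n := by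
  obtain ⟨m, rfl⟩ : ∃ m, n = m + 1 := ⟨n - 1, by omega⟩
  exact roundsUpTo_succ B m

theorem card_playedBlock (hB : ∀ n, 1 ≤ B n) (T : ℕ) {n : ℕ} (hn : 1 ≤ n) :
    (playedBlock B T n).card = truncLen B T n := by
  rw [playedBlock_eq_Ioc hB T hn, Nat.card_Ioc, truncLen, roundsUpTo_eq_pred_add hn]
  omega

theorem playedBlock_eq_block (hB : ∀ n, 1 ≤ B n) {T n : ℕ} (hn : 1 ≤ n)
    (h : n < numBlocks B T) : playedBlock B T n = block B n := by
  rw [playedBlock_eq_Ioc hB T hn, min_eq_left (roundsUpTo_lt h).le, block]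

theorem truncLen_pos (hB : ∀ n, 1 ≤ B n) {T n : ℕ} (hn : 1 ≤ n) (h : n ≤ numBlocks B T) :
    1 ≤ truncLen B T n := by
  have := roundsUpTo_lt (show n - 1 < numBlocks B T by omega)
  have := hB n
  rw [truncLen]
  omega

theorem numBlocks_mem_Icc (hB : ∀ n, 1 ≤ B n) {T t : ℕ} (ht : t ∈ Finset.Icc 1 T) :
    numBlocks B t ∈ Finset.Icc 1 (numBlocks B T) := by
  obtain ⟨h1, h2⟩ := Finset.mem_Icc.mp ht
  refine Finset.mem_Icc.mpr ⟨?_, numBlocks_le (h2.trans (le_roundsUpTo_numBlocks hB T))⟩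
  by_contra h
  have h0 : numBlocks B t = 0 := by omega
  have := le_roundsUpTo_numBlocks hB t
  rw [h0] at this
  simp [roundsUpTo] at this
  omega

theorem sum_rounds_eq_sum_blocks (hB : ∀ n, 1 ≤ B n) (T : ℕ) (f : ℕ → ℕ → ℝ) :
    ∑ t ∈ Finset.Icc 1 T, f t (numBlocks B t) =
      ∑ n ∈ Finset.Icc 1 (numBlocks B T), ∑ t ∈ playedBlock B T n, f t n := by
  rw [← Finset.sum_fiberwise_of_maps_to fun t ht => numBlocks_mem_Icc hB ht]
  refine Finset.sum_congr rfl fun n _ => Finset.sum_congr rfl fun t ht => ?_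
  rw [(Finset.mem_filter.mp ht).2]

end Blocks

/-! ### The game as a game over blocks -/

section Reduction

variable {K : ℕ} {Ω : Type*}

/-- The cumulative losses over the played rounds of block `n`. -/
noncomputable def playedLoss (B : ℕ → ℕ) (T : ℕ) (loss : ℕ → Ω → Fin K → ℝ) (n : ℕ) (ω : Ω)
    (i : Fin K) : ℝ :=
  ∑ t ∈ playedBlock B T n, loss t ω i

variable [NeZero K] [mΩ : MeasurableSpace Ω] {μ : Measure Ω} [IsProbabilityMeasure μ]
  {η : ℕ → ℝ} {B : ℕ → ℕ} {loss : ℕ → Ω → Fin K → ℝ} {I : ℕ → Ω → Fin K}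

omit [NeZero K] mΩ in
theorem measurable_loss_history {t : ℕ} (ht : 1 ≤ t) (n : ℕ) (i : Fin K) :
    Measurable[history loss I n] fun ω => loss t ω i := by
  have h : MeasurableSpace.comap (loss t) inferInstance ≤ history loss I n :=
    le_sup_of_le_left (le_iSup₂_of_le t ht le_rfl)
  exact (measurable_pi_apply i).comp ((comap_measurable (loss t)).mono h le_rfl)

omit [NeZero K] mΩ in
theorem measurable_loss_past {s t : ℕ} (hs : 1 ≤ s) (hst : s < t) (i : Fin K) :
    Measurable[pastLosses loss t] fun ω => loss s ω i := by
  have h : MeasurableSpace.comap (loss s) inferInstance ≤ pastLosses loss t :=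
    le_iSup₂_of_le s ⟨hs, hst⟩ le_rfl
  exact (measurable_pi_apply i).comp ((comap_measurable (loss s)).mono h le_rfl)

omit [NeZero K] mΩ in
theorem pastLosses_le_history (t n : ℕ) : pastLosses loss t ≤ history loss I n :=
  le_sup_of_le_left (iSup₂_le fun s hs => le_iSup₂_of_le s hs.1 le_rfl)

omit [NeZero K] in
theorem pastLosses_le (hloss : IsLossProcess loss) (t : ℕ) : pastLosses loss t ≤ mΩ :=
  iSup₂_le fun s hs => (hloss.measurable s hs.1).comap_le

omit [NeZero K] in
theorem bddMeasurable_loss (hloss : IsLossProcess loss) {t : ℕ} (ht : 1 ≤ t) (i : Fin K) :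
    BddMeasurable mΩ fun ω => loss t ω i :=
  .of_mem_Icc ((measurable_pi_apply i).comp (hloss.measurable t ht))
    fun ω => hloss.mem_Icc t ht ω i

omit [IsProbabilityMeasure μ] in
theorem isBlockGame (hη0 : η 0 = 0) (hη : ∀ n, 1 ≤ n → 0 < η n) (hB : ∀ n, 1 ≤ B n)
    (hloss : IsLossProcess loss) (hI : IsTsallisSwitch μ η B loss I) (T : ℕ) :
    IsBlockGame μ η (history loss I) (playedLoss B T loss) I
      (fun n => ((playedBlock B T n).card : ℝ)) (numBlocks B T) where
  rate_zero := hη0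
  rate_pos := hη
  le n := sup_le (iSup₂_le fun t ht => (hloss.measurable t ht).comap_le)
    (iSup₂_le fun m hm => (hI.measurable m hm.1).comap_le)
  measurable_loss n m i := Finset.measurable_sum _ fun t ht =>
    measurable_loss_history (mem_playedBlock.mp ht).1.1 n i
  loss_mem n ω i := by
    have h := fun t (ht : t ∈ playedBlock B T n) =>
      hloss.mem_Icc t (mem_playedBlock.mp ht).1.1 ω i
    refine ⟨Finset.sum_nonneg fun t ht => (h t ht).1, ?_⟩
    simpa [playedLoss] using Finset.sum_le_card_nsmul _ _ 1 fun t ht => (h t ht).2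
  measurable_arm := hI.measurable
  measurable_past_arm n m h1 h2 :=
    (comap_measurable (I m)).mono (le_sup_of_le_right (le_iSup₂_of_le m ⟨h1, h2⟩ le_rfl)) le_rfl
  law n h1 h2 i := by
    have h := hI.law n h1 i
    have e1 : Set.indicator {ω | I n ω = i} (fun _ => (1 : ℝ)) =
        fun ω => if I n ω = i then (1 : ℝ) else 0 := by ext; simp [Set.indicator]
    have e2 : (fun ω => playDist η B (fun t => loss t ω) (fun m => I m ω) n i) =
        fun ω => armDist η (playedLoss B T loss) I n ω i := by
      -- The algorithm works with full blocks, the regret with played ones. The draw in block `n`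
      -- uses only earlier blocks, and these are not truncated.
      ext ω
      rw [playDist, armDist, cumEst_congr η (I' := fun m => I m ω) _ fun _ _ _ => rfl]
      intro m hm1 hm2
      ext j
      rw [blockLoss, playedLoss, playedBlock_eq_block hB hm1 (by omega)]
    rwa [e1, e2] at h

omit [NeZero K] in
theorem integral_playedLoss (hloss : IsLossProcess loss) (T n : ℕ) (i : Fin K) :
    ∫ ω, playedLoss B T loss n ω i ∂μ = ∑ t ∈ playedBlock B T n, ∫ ω, loss t ω i ∂μ :=
  integral_finsetSum _ fun _ ht =>
    (bddMeasurable_loss hloss (mem_playedBlock.mp ht).1.1 i).integrable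

omit [NeZero K] in
theorem integral_sum_loss (hB : ∀ n, 1 ≤ B n) (hloss : IsLossProcess loss) (T : ℕ) (i : Fin K) :
    ∫ ω, ∑ t ∈ Finset.Icc 1 T, loss t ω i ∂μ =
      ∑ n ∈ Finset.Icc 1 (numBlocks B T), ∫ ω, playedLoss B T loss n ω i ∂μ := by
  simp_rw [integral_playedLoss hloss]
  rw [← sum_rounds_eq_sum_blocks hB T fun t _ => ∫ ω, loss t ω i ∂μ]
  exact integral_finsetSum _ fun t ht =>
    (bddMeasurable_loss hloss (Finset.mem_Icc.mp ht).1 i).integrable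

omit [NeZero K] [IsProbabilityMeasure μ] in
theorem integral_sum_playedLoss (hB : ∀ n, 1 ≤ B n) (T : ℕ) :
    ∫ ω, ∑ t ∈ Finset.Icc 1 T, loss t ω (I (numBlocks B t) ω) ∂μ =
      ∫ ω, ∑ n ∈ Finset.Icc 1 (numBlocks B T), playedLoss B T loss n ω (I n ω) ∂μ := by
  congr 1
  ext ω
  exact sum_rounds_eq_sum_blocks hB T fun t n => loss t ω (I n ω)

theorem exists_pseudoRegret_eq (hB : ∀ n, 1 ≤ B n) (hloss : IsLossProcess loss) (T : ℕ) :
    ∃ k, pseudoRegret μ B loss I T =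
      ∫ ω, ∑ n ∈ Finset.Icc 1 (numBlocks B T), playedLoss B T loss n ω (I n ω) ∂μ -
        ∑ n ∈ Finset.Icc 1 (numBlocks B T), ∫ ω, playedLoss B T loss n ω k ∂μ := by
  obtain ⟨k, hk⟩ := exists_eq_ciInf_of_finite
    (f := fun i : Fin K => ∫ ω, ∑ t ∈ Finset.Icc 1 T, loss t ω i ∂μ)
  exact ⟨k, by rw [pseudoRegret, ← hk, integral_sum_playedLoss hB, integral_sum_loss hB hloss]⟩

/-! ### Stochastically constrained losses -/

variable {D : Fin K → Fin K → ℝ}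

omit [NeZero K] in
theorem StochasticallyConstrained.integral_sub (hD : StochasticallyConstrained μ loss D)
    (hloss : IsLossProcess loss) {t : ℕ} (ht : 1 ≤ t) (i j : Fin K) :
    ∫ ω, loss t ω i ∂μ - ∫ ω, loss t ω j ∂μ = D i j := by
  rw [← MeasureTheory.integral_sub (bddMeasurable_loss hloss ht i).integrable
    (bddMeasurable_loss hloss ht j).integrable, ← integral_condExp (pastLosses_le hloss t),
    integral_congr_ae (hD t ht i j)]
  simp

theorem gap_nonneg (D : Fin K → Fin K → ℝ) (i : Fin K) : 0 ≤ gap D i :=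
  sub_nonneg.mpr (ciInf_le (Set.finite_range _).bddBelow i)

/-- Mean differences are additive, so the reference arm in `gap` can be replaced by the best arm,
whose gap is zero. -/
theorem StochasticallyConstrained.eq_gap (hD : StochasticallyConstrained μ loss D)
    (hloss : IsLossProcess loss) {k : Fin K} (hk : IsUniqueBestArm D k) (i : Fin K) :
    D i k = gap D i := by
  have h1 : gap D k = 0 := (hk k).mpr rfl
  have h2 := hD.integral_sub hloss le_rfl i 0
  have h3 := hD.integral_sub hloss le_rfl k 0
  have h4 := hD.integral_sub hloss le_rfl i k
  rw [gap] at h1 ⊢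
  linarith

theorem StochasticallyConstrained.pseudoRegret_eq (hD : StochasticallyConstrained μ loss D)
    (hB : ∀ n, 1 ≤ B n) (hloss : IsLossProcess loss) {k : Fin K} (hk : IsUniqueBestArm D k)
    (T : ℕ) :
    pseudoRegret μ B loss I T =
      ∫ ω, ∑ n ∈ Finset.Icc 1 (numBlocks B T), playedLoss B T loss n ω (I n ω) ∂μ -
        ∑ n ∈ Finset.Icc 1 (numBlocks B T), ∫ ω, playedLoss B T loss n ω k ∂μ := by
  have h : ⨅ i, ∫ ω, ∑ t ∈ Finset.Icc 1 T, loss t ω i ∂μ =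
      ∫ ω, ∑ t ∈ Finset.Icc 1 T, loss t ω k ∂μ := by
    refine le_antisymm (ciInf_le (Set.finite_range _).bddBelow k) (le_ciInf fun i => ?_)
    rw [integral_finsetSum _ fun t ht =>
        (bddMeasurable_loss hloss (Finset.mem_Icc.mp ht).1 k).integrable,
      integral_finsetSum _ fun t ht =>
        (bddMeasurable_loss hloss (Finset.mem_Icc.mp ht).1 i).integrable]
    refine Finset.sum_le_sum fun t ht => ?_
    have h1 := hD.integral_sub hloss (Finset.mem_Icc.mp ht).1 i k
    rw [hD.eq_gap hloss hk] at h1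
    linarith [gap_nonneg D i]
  rw [pseudoRegret, h, integral_sum_playedLoss hB, integral_sum_loss hB hloss]

theorem StochasticallyConstrained.integral_regret_round (hD : StochasticallyConstrained μ loss D)
    (hB : ∀ n, 1 ≤ B n) (hloss : IsLossProcess loss) {k : Fin K} (hk : IsUniqueBestArm D k)
    {T : ℕ} (hG : IsBlockGame μ η (history loss I) (playedLoss B T loss) I
      (fun n => ((playedBlock B T n).card : ℝ)) (numBlocks B T)) {n t : ℕ} (hn : 1 ≤ n)
    (hN : n ≤ numBlocks B T) (ht : t ∈ playedBlock B T n) :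
    ∫ ω, loss t ω (I n ω) ∂μ - ∫ ω, loss t ω k ∂μ =
      ∑ i ∈ Finset.univ.erase k,
        gap D i * ∫ ω, armDist η (playedLoss B T loss) I n ω i ∂μ := by
  obtain ⟨⟨ht1, -⟩, htn⟩ := mem_playedBlock.mp ht
  have hg : ∀ i n, BddMeasurable (history loss I n) fun ω => loss t ω i - loss t ω k := fun i n =>
    (BddMeasurable.of_mem_Icc (measurable_loss_history ht1 n i)
      fun ω => hloss.mem_Icc t ht1 ω i).sub
    (.of_mem_Icc (measurable_loss_history ht1 n k) fun ω => hloss.mem_Icc t ht1 ω k)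
  have h1 : ∀ i, ∫ ω, (if I n ω = i then 1 else 0) * (loss t ω i - loss t ω k) ∂μ =
      gap D i * ∫ ω, armDist η (playedLoss B T loss) I n ω i ∂μ := fun i => by
    rw [← hD.eq_gap hloss hk]
    refine hG.integral_indicator_arm_mul (pastLosses_le hloss t) (pastLosses_le_history t) hn hN
      (fun m hm1 hm2 j => Finset.measurable_sum _ fun s hs => ?_) (hg i) (hD t ht1 i k) i
    obtain ⟨⟨hs1, -⟩, hsm⟩ := mem_playedBlock.mp hs
    refine measurable_loss_past hs1 ?_ j
    -- Rounds of earlier blocks precede `t`, since the block index is monotone in the round.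
    by_contra hts
    have := numBlocks_le ((not_lt.mp hts).trans (le_roundsUpTo_numBlocks hB s))
    omega
  have hl : ∀ i, BddMeasurable (history loss I n) fun ω => loss t ω i := fun i =>
    .of_mem_Icc (measurable_loss_history ht1 n i) fun ω => hloss.mem_Icc t ht1 ω i
  rw [← MeasureTheory.integral_sub (hG.bddMeasurable_comp_arm hn hl).integrable
    ((hl k).mono (hG.le n)).integrable]
  have h2 : ∀ ω, loss t ω (I n ω) - loss t ω k =
      ∑ i, (if I n ω = i then 1 else 0) * (loss t ω i - loss t ω k) := fun ω => by simp
  simp_rw [h2]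
  rw [integral_finsetSum _ fun i _ => ((BddMeasurable.indicator_eq (hG.measurable_arm n hn) i).mul
    ((hg i n).mono (hG.le n))).integrable, Finset.sum_congr rfl fun i _ => h1 i,
    ← Finset.add_sum_erase _ _ (Finset.mem_univ k), (hk k).mpr rfl, zero_mul, zero_add]

/-- In the stochastically constrained regime the pseudo-regret is determined by the gaps. -/
theorem StochasticallyConstrained.pseudoRegret_eq_sum_gap
    (hD : StochasticallyConstrained μ loss D)
    (hB : ∀ n, 1 ≤ B n) (hloss : IsLossProcess loss) {k : Fin K} (hk : IsUniqueBestArm D k)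
    {T : ℕ} (hG : IsBlockGame μ η (history loss I) (playedLoss B T loss) I
      (fun n => ((playedBlock B T n).card : ℝ)) (numBlocks B T)) :
    pseudoRegret μ B loss I T = ∑ n ∈ Finset.Icc 1 (numBlocks B T), ∑ i ∈ Finset.univ.erase k,
      (truncLen B T n : ℝ) * (gap D i * ∫ ω, armDist η (playedLoss B T loss) I n ω i ∂μ) := by
  have hm : ∀ n ∈ Finset.Icc 1 (numBlocks B T), ∀ t ∈ playedBlock B T n,
      BddMeasurable mΩ fun ω => loss t ω (I n ω) := fun n hn t ht =>
    have ht1 := (mem_playedBlock.mp ht).1.1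
    hG.bddMeasurable_comp_arm (Finset.mem_Icc.mp hn).1 fun i =>
      .of_mem_Icc (measurable_loss_history ht1 n i) fun ω => hloss.mem_Icc t ht1 ω i
  rw [hD.pseudoRegret_eq hB hloss hk, integral_finsetSum (f := fun n ω =>
    playedLoss B T loss n ω (I n ω)) _ fun n hn => (BddMeasurable.sum _ (hm n hn)).integrable,
    ← Finset.sum_sub_distrib]
  refine Finset.sum_congr rfl fun n hn => ?_
  obtain ⟨h1, h2⟩ := Finset.mem_Icc.mp hn
  rw [integral_playedLoss hloss, ← card_playedBlock hB T h1, ← Finset.mul_sum]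
  unfold playedLoss
  rw [integral_finsetSum _ fun t ht => (hm n hn t ht).integrable, ← Finset.sum_sub_distrib,
    Finset.sum_congr rfl fun t ht => hD.integral_regret_round hB hloss hk hG h1 h2 ht,
    Finset.sum_const, nsmul_eq_mul]
  rfl

/-! ### Switching costs -/

omit [NeZero K] in
theorem switchingCost_le_sum {lam : ℕ → ℝ} (hlam : ∀ n, 1 ≤ n → 0 ≤ lam n) (T : ℕ) :
    switchingCost μ B lam I T ≤ ∑ n ∈ Finset.Icc 1 (numBlocks B T), lam n :=
  Finset.sum_le_sum fun n hn =>
    mul_le_of_le_one_right (hlam n (Finset.mem_Icc.mp hn).1) measureReal_le_one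

omit [NeZero K] in
-- A switch means that the arm before or after it differs from `k`, so each visit to another arm is
-- charged for entering and leaving. The initial draw is charged `lam 1`.
theorem sum_switching_le {lam : ℕ → ℝ} (hlam : ∀ n, 1 ≤ n → 0 ≤ lam n) (k : Fin K) (N : ℕ) :
    ∑ n ∈ Finset.Icc 1 N, lam n * μ.real {ω | some (I n ω) ≠ prevArm I n ω} ≤
      lam 1 + ∑ n ∈ Finset.Icc 1 N, (lam n + lam (n + 1)) * μ.real {ω | I n ω ≠ k} := by
  have hstep : ∀ n, 1 ≤ n → μ.real {ω | some (I (n + 1) ω) ≠ prevArm I (n + 1) ω} ≤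
      μ.real {ω | I (n + 1) ω ≠ k} + μ.real {ω | I n ω ≠ k} := fun n hn => by
    refine (measureReal_mono ?_).trans (measureReal_union_le _ _)
    intro ω h
    by_contra h'
    simp only [Set.mem_union, Set.mem_ofPred_eq, not_or, not_not] at h'
    refine h ?_
    rw [prevArm, if_neg (by omega), Nat.add_sub_cancel, h'.1, h'.2]
  rcases N with - | N
  · simpa using hlam 1 le_rfl
  -- The extra term reserves the cost of leaving the last block, which the induction step spends.
  have main : ∑ n ∈ Finset.Icc 1 (N + 1), lam n * μ.real {ω | some (I n ω) ≠ prevArm I n ω} +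
      lam (N + 2) * μ.real {ω | I (N + 1) ω ≠ k} ≤
      lam 1 + ∑ n ∈ Finset.Icc 1 (N + 1), (lam n + lam (n + 1)) * μ.real {ω | I n ω ≠ k} := by
    induction N with
    | zero =>
      simp only [zero_add, Finset.Icc_self, Finset.sum_singleton]
      have h1 := mul_le_of_le_one_right (hlam 1 le_rfl)
        (measureReal_le_one (μ := μ) (s := {ω | some (I 1 ω) ≠ prevArm I 1 ω}))
      have h2 := mul_nonneg (hlam 1 le_rfl) (measureReal_nonneg (μ := μ) (s := {ω | I 1 ω ≠ k}))
      linarith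
    | succ N ih =>
      rw [Finset.sum_Icc_succ_top (b := N + 1) (by omega),
        Finset.sum_Icc_succ_top (b := N + 1) (by omega)]
      have h1 := mul_le_mul_of_nonneg_left (hstep (N + 1) (by omega)) (hlam (N + 1 + 1) (by omega))
      linarith
  have := mul_nonneg (hlam (N + 2) (by omega))
    (measureReal_nonneg (μ := μ) (s := {ω | I (N + 1) ω ≠ k}))
  linarith

end Reduction

/-! ### Estimates for the tuning -/

section Tuning

variable {K : ℕ} [NeZero K] {lam : ℕ → ℝ}

theorem sum_inv_sqrt_le (N : ℕ) : ∑ n ∈ Finset.Icc 1 N, 1 / √(n : ℝ) ≤ 2 * √(N : ℝ) := by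
  induction N with
  | zero => simp
  | succ N ih =>
    rw [Finset.sum_Icc_succ_top (by omega)]
    have h1 : √(N : ℝ) ≤ √((N + 1 : ℕ) : ℝ) := Real.sqrt_le_sqrt (by push_cast; linarith)
    have h2 := Real.sq_sqrt (Nat.cast_nonneg (α := ℝ) N)
    have h3 := Real.sq_sqrt (Nat.cast_nonneg (α := ℝ) (N + 1))
    have h4 : 0 < √((N + 1 : ℕ) : ℝ) := Real.sqrt_pos.mpr (by positivity)
    have h5 : 1 / √((N + 1 : ℕ) : ℝ) ≤ 2 * √((N + 1 : ℕ) : ℝ) - 2 * √(N : ℝ) := by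
      rw [div_le_iff₀ h4]
      push_cast at *
      nlinarith [sq_nonneg (√((N : ℝ) + 1) - √(N : ℝ))]
    linarith

omit [NeZero K] in
theorem sqrt_mul_sqrt_le_aSeq (hlam : ∀ n, 1 ≤ n → 0 ≤ lam n) (n : ℕ) :
    √(K : ℝ) * √(n : ℝ) ≤ aSeq K lam n := by
  have h : ∀ s ∈ Finset.Icc 1 n, √(K : ℝ) / √(n : ℝ) ≤ lam s + √((K : ℝ) / (s : ℝ)) := by
    intro s hs
    obtain ⟨h1, h2⟩ := Finset.mem_Icc.mp hs
    have : (0 : ℝ) < s := by exact_mod_cast h1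
    have h3 : √(K : ℝ) / √(n : ℝ) ≤ √((K : ℝ) / (s : ℝ)) := by
      rw [Real.sqrt_div' _ this.le]
      have : (s : ℝ) ≤ n := by exact_mod_cast h2
      gcongr
    linarith [hlam s h1]
  have h4 := Finset.card_nsmul_le_sum _ _ _ h
  rw [Nat.card_Icc, Nat.add_sub_cancel, nsmul_eq_mul] at h4
  refine le_trans (le_of_eq ?_) h4
  rcases eq_or_ne n 0 with rfl | hn
  · simp
  · have h5 : √(n : ℝ) ≠ 0 := (Real.sqrt_pos.mpr (by positivity)).ne'
    have h6 := Real.sq_sqrt (Nat.cast_nonneg (α := ℝ) n)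
    field_simp
    rw [h6]

theorem sqrt_card_pos : 0 < √(K : ℝ) := Real.sqrt_pos.mpr (by exact_mod_cast NeZero.pos K)

theorem aSeq_pos (hlam : ∀ n, 1 ≤ n → 0 ≤ lam n) {n : ℕ} (hn : 1 ≤ n) : 0 < aSeq K lam n :=
  lt_of_lt_of_le (mul_pos sqrt_card_pos (Real.sqrt_pos.mpr (by exact_mod_cast hn)))
    (sqrt_mul_sqrt_le_aSeq hlam n)

theorem etaSeq_pos (hlam : ∀ n, 1 ≤ n → 0 ≤ lam n) {n : ℕ} (hn : 1 ≤ n) : 0 < etaSeq K lam n := by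
  have h1 := aSeq_pos (K := K) hlam hn
  have h2 : 0 < √(2 * (K : ℝ)) := Real.sqrt_pos.mpr (by have := NeZero.pos K; positivity)
  unfold etaSeq
  positivity

omit [NeZero K] in
theorem etaSeq_zero : etaSeq K lam 0 = 0 := by simp [etaSeq, aSeq]

theorem inv_etaSeq_sub {n : ℕ} (hn : 1 ≤ n) :
    1 / etaSeq K lam n - 1 / etaSeq K lam (n - 1) =
      3 * √2 / 4 * (lam n / √(K : ℝ) + 1 / √(n : ℝ)) := by
  obtain ⟨m, rfl⟩ : ∃ m, n = m + 1 := ⟨n - 1, by omega⟩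
  have h1 : aSeq K lam (m + 1) = aSeq K lam m + (lam (m + 1) + √(K : ℝ) / √((m + 1 : ℕ) : ℝ)) := by
    rw [← Real.sqrt_div (Nat.cast_nonneg _)]
    exact Finset.sum_Icc_succ_top (by omega) _
  have hK := sqrt_card_pos (K := K)
  have h2 : √2 * √2 = (2 : ℝ) := Real.mul_self_sqrt (by norm_num)
  have h3 : (0 : ℝ) < √2 := Real.sqrt_pos.mpr (by norm_num)
  have h4 : 0 < √((m + 1 : ℕ) : ℝ) := Real.sqrt_pos.mpr (by positivity)
  rw [Nat.add_sub_cancel, etaSeq, etaSeq, one_div_div, one_div_div, h1,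
    Real.sqrt_mul (by norm_num)]
  generalize √((m + 1 : ℕ) : ℝ) = r at *
  generalize √(K : ℝ) = k at *
  field_simp
  linear_combination (-2 * (lam (m + 1) * r + k)) * h2

/-- Rounding up gives `b ≤ √x + 1` with `x = lam n * a n / K`, hence `b ^ 2 ≤ 2 x + 2`. In the
product with `η n` the factor `a n` cancels from the first part, and `a n ≥ √K √n` controls the
second. -/
theorem etaSeq_mul_sq_le (hlam : ∀ n, 1 ≤ n → 0 ≤ lam n) {n : ℕ} (hn : 1 ≤ n) {b : ℝ}
    (hb : 0 ≤ b) (hbn : b ≤ lenSeq K lam n) :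
    etaSeq K lam n * b ^ 2 ≤ 4 * √2 / 3 * (lam n / √(K : ℝ) + 1 / √(n : ℝ)) := by
  have ha := aSeq_pos (K := K) hlam hn
  have hK := sqrt_card_pos (K := K)
  have hKK : √(K : ℝ) ^ 2 = K := Real.sq_sqrt (Nat.cast_nonneg _)
  have hl := hlam n hn
  have hn' : 0 < √(n : ℝ) := Real.sqrt_pos.mpr (by exact_mod_cast hn)
  set x := lam n * aSeq K lam n / (K : ℝ) with hx
  have hx0 : 0 ≤ x := by positivity
  have h1 : b ≤ √x + 1 := by
    refine hbn.trans ?_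
    rw [lenSeq, Nat.cast_max]
    refine max_le (Nat.ceil_lt_add_one (Real.sqrt_nonneg _)).le ?_
    simp
  have h2 : b ^ 2 ≤ 2 * x + 2 := by
    have h3 := pow_le_pow_left₀ hb h1 2
    nlinarith [Real.sq_sqrt hx0, sq_nonneg (√x - 1)]
  have h3 : etaSeq K lam n * (2 * x + 2) =
      4 * √2 / 3 * (lam n / √(K : ℝ) + √(K : ℝ) / aSeq K lam n) := by
    have hx' : x = lam n * aSeq K lam n / √(K : ℝ) ^ 2 := by rw [hKK]
    rw [etaSeq, Real.sqrt_mul (by norm_num), hx']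
    generalize √(K : ℝ) = k at *
    field_simp
    ring
  have h4 : √(K : ℝ) / aSeq K lam n ≤ 1 / √(n : ℝ) := by
    rw [div_le_div_iff₀ ha hn', one_mul]
    exact sqrt_mul_sqrt_le_aSeq hlam n
  calc _ ≤ etaSeq K lam n * (2 * x + 2) :=
        mul_le_mul_of_nonneg_left h2 (etaSeq_pos hlam hn).le
    _ ≤ _ := by rw [h3]; gcongr

omit [NeZero K] in
theorem one_le_lenSeq (n : ℕ) : 1 ≤ lenSeq K lam n := le_max_right _ _

omit [NeZero K] in
theorem truncLen_le (B : ℕ → ℕ) (T n : ℕ) : truncLen B T n ≤ B n := min_le_left _ _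

theorem mul_truncLen_le_of_smallStepIndex_lt {η : ℕ → ℝ} {B : ℕ → ℕ} {T n : ℕ}
    (h : smallStepIndex η B T < n) (hn : n ≤ numBlocks B T) :
    η n * (truncLen B T n : ℝ) ≤ 1 / 4 := by
  unfold smallStepIndex at h
  split_ifs at h with hne
  · exact (Nat.sInf_mem hne).2.2 n h.le hn
  · omega

omit [NeZero K] in
theorem sum_sqrt_le {p : Fin K → ℝ} (hp : p ∈ stdSimplex ℝ (Fin K)) :
    ∑ i, √(p i) ≤ √(K : ℝ) := by
  refine Real.le_sqrt_of_sq_le ?_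
  have h := sq_sum_le_card_mul_sum_sq (s := Finset.univ) (f := fun i => √(p i))
  simp only [Real.sq_sqrt (hp.1 _), hp.2, Finset.card_univ, Fintype.card_fin, mul_one] at h
  exact h

theorem cumEst_eq_add_lossEst (η : ℕ → ℝ) (c : ℕ → Fin K → ℝ) (I : ℕ → Fin K) {n : ℕ}
    (hn : 1 ≤ n) : cumEst η c I n = fun i => cumEst η c I (n - 1) i +
      lossEst (tsallisDist (η n) (cumEst η c I (n - 1))) (c n) (I n) i := by
  obtain ⟨m, rfl⟩ : ∃ m, n = m + 1 := ⟨n - 1, by omega⟩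
  rfl

/-- Since `s ^ 2 ≤ s`, the left side is at most `M s - d s ^ 2`, whose maximum is `M ^ 2 / (4 d)`.
Here `s = √(p i)`, `A` collects stability and penalty, `L` the switching costs, and `d` is block
length times gap. -/
theorem self_bounding_le {A L d M s : ℝ} (hs : s ∈ Set.Icc (0 : ℝ) 1) (hd : 0 < d)
    (hL : 0 ≤ L) (hM : 2 * A + L ≤ M) :
    2 * (A * s) + (L - d) * s ^ 2 ≤ M ^ 2 / (4 * d) := by
  have h1 : s ^ 2 ≤ s := by nlinarith [hs.1, hs.2]
  have h2 : L * s ^ 2 ≤ L * s := mul_le_mul_of_nonneg_left h1 hL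
  have h3 : (2 * A + L) * s ≤ M * s := mul_le_mul_of_nonneg_right hM hs.1
  rw [le_div_iff₀ (by linarith)]
  nlinarith [sq_nonneg (M - 2 * d * s)]

end Tuning

/-! ### The adversarial and the stochastic regret bound -/

section Regret

variable {K : ℕ} [NeZero K] {Ω : Type*} [mΩ : MeasurableSpace Ω] {μ : Measure Ω}
  [IsProbabilityMeasure μ] {lam : ℕ → ℝ} {loss : ℕ → Ω → Fin K → ℝ} {I : ℕ → Ω → Fin K} {T : ℕ}

theorem regretWithSwitching_le_adversarial (hlam : ∀ n, 1 ≤ n → 0 ≤ lam n)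
    (hloss : IsLossProcess loss) (hI : IsTsallisSwitch μ (etaSeq K lam) (lenSeq K lam) loss I) :
    regretWithSwitching μ (lenSeq K lam) lam loss I T ≤
        (∑ n ∈ Finset.Icc 1 (numBlocks (lenSeq K lam) T), 7 * lam n) +
          12 * √((K : ℝ) * (numBlocks (lenSeq K lam) T : ℝ)) := by
  have hB : ∀ n, 1 ≤ lenSeq K lam n := one_le_lenSeq
  have hG := isBlockGame etaSeq_zero (fun n hn => etaSeq_pos hlam hn) hB hloss hI T
  obtain ⟨k, hk⟩ := exists_pseudoRegret_eq (μ := μ) (I := I) hB hloss T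
  set N := numBlocks (lenSeq K lam) T
  set η := etaSeq K lam
  set c := playedLoss (lenSeq K lam) T loss
  have h1 := hG.expected_regret_le
    (G := fun n ω i => ivBound (η n) (armDist η c I n ω) (c n ω) i)
    (fun n hn i => hG.bddMeasurable_ivBound hn i)
    (fun n hn _ ω => by
      rw [cumEst_eq_add_lossEst η (fun m => c m ω) (fun m => I m ω) hn]
      exact le_minObjective_add_ivBound (hG.rate_pos n hn) _ _ _ (hG.loss_mem n ω _).1) k
  rw [← hk] at h1
  have h2 : ∀ n ∈ Finset.Icc 1 N, ∫ ω, (∑ i, armDist η c I n ω i *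
        ivBound (η n) (armDist η c I n ω) (c n ω) i +
        (1 / η n - 1 / η (n - 1)) * (4 * ∑ i, √(armDist η c I n ω i) - 4)) ∂μ ≤
      6 * lam n + 6 * √(K : ℝ) * (1 / √(n : ℝ)) := by
    intro n hn
    obtain ⟨hn1, -⟩ := Finset.mem_Icc.mp hn
    have hK := sqrt_card_pos (K := K)
    have hsqrt2 : √2 ≤ (3 / 2 : ℝ) := Real.sqrt_le_iff.mpr (by norm_num)
    have hl := hlam n hn1
    have hint : BddMeasurable mΩ fun ω => ∑ i, armDist η c I n ω i *
        ivBound (η n) (armDist η c I n ω) (c n ω) i +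
        (1 / η n - 1 / η (n - 1)) * (4 * ∑ i, √(armDist η c I n ω i) - 4) :=
      ((BddMeasurable.sum _ fun i _ => (hG.bddMeasurable_armDist hn1 i).mul
        (hG.bddMeasurable_ivBound hn1 i)).add
        ((((BddMeasurable.sum _ fun i _ => hG.bddMeasurable_sqrt_armDist hn1
          i).const_mul 4).sub (.const 4)).const_mul _)).mono (hG.le n)
    refine (integral_mono hint.integrable (integrable_const _) fun ω => ?_).trans_eq
      (by simp : ∫ _, (6 * lam n + 6 * √(K : ℝ) * (1 / √(n : ℝ))) ∂μ = _)
    have h3 := sum_mul_ivBound_le (hG.rate_pos n hn1) (hG.armDist_pos hn1 ω)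
      (hG.loss_mem n ω)
    have h4 : η n * ((playedBlock (lenSeq K lam) T n).card : ℝ) ^ 2 ≤ _ :=
      etaSeq_mul_sq_le (K := K) hlam hn1 (Nat.cast_nonneg _) (by
        rw [card_playedBlock hB T hn1]; exact_mod_cast truncLen_le _ _ _)
    have h5 : ∑ i, √(armDist η c I n ω i) ≤ √(K : ℝ) := sum_sqrt_le (tsallisDist_spec _ _).1
    have h6 : 0 ≤ ∑ i, √(armDist η c I n ω i) := Finset.sum_nonneg fun _ _ => Real.sqrt_nonneg _
    dsimp only
    rw [inv_etaSeq_sub hn1]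
    set y := lam n / √(K : ℝ) + 1 / √(n : ℝ) with hy
    have hy0 : 0 ≤ y := by positivity
    have hKy : √(K : ℝ) * y = lam n + √(K : ℝ) * (1 / √(n : ℝ)) := by
      rw [hy]; field_simp
    set W := ∑ i, √(armDist η c I n ω i)
    have h7 : η n / 2 * ((playedBlock (lenSeq K lam) T n).card : ℝ) ^ 2 * W ≤
        4 * √2 / 3 * y / 2 * √(K : ℝ) :=
      mul_le_mul (by linarith) h5 h6 (by positivity)
    have h8 : 3 * √2 / 4 * y * (4 * W - 4) ≤ 3 * √2 / 4 * y * (4 * √(K : ℝ)) :=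
      mul_le_mul_of_nonneg_left (by linarith) (by positivity)
    have h9 : √2 * (√(K : ℝ) * y) ≤ 3 / 2 * (√(K : ℝ) * y) :=
      mul_le_mul_of_nonneg_right hsqrt2 (by positivity)
    -- Stability contributes `2√2/3` and the penalty `3√2` times `√K * y`; the sum `11√2/3` is below
    -- `6`.
    nlinarith
  have h3 := Finset.sum_le_sum h2
  rw [Finset.sum_add_distrib, ← Finset.mul_sum, ← Finset.mul_sum] at h3
  have h4 := mul_le_mul_of_nonneg_left (sum_inv_sqrt_le N)
    (show 0 ≤ 6 * √(K : ℝ) by positivity)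
  have h5 : switchingCost μ (lenSeq K lam) lam I T ≤ _ := switchingCost_le_sum hlam T
  rw [regretWithSwitching, ← Finset.mul_sum, Real.sqrt_mul (Nat.cast_nonneg _)]
  linarith

theorem regretWithSwitching_le_stochastic (hlam : ∀ n, 1 ≤ n → 0 ≤ lam n)
    (hloss : IsLossProcess loss) (hI : IsTsallisSwitch μ (etaSeq K lam) (lenSeq K lam) loss I)
    {D : Fin K → Fin K → ℝ} {k : Fin K} (hD : StochasticallyConstrained μ loss D)
    (hk : IsUniqueBestArm D k) :
    regretWithSwitching μ (lenSeq K lam) lam loss I T ≤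
      (∑ n ∈ Finset.Icc 1 (numBlocks (lenSeq K lam) T), ∑ i ∈ Finset.univ.erase k,
        (11 * lam n + lam (n + 1) + 10 * √2 / √(n : ℝ)) ^ 2 /
          (4 * gap D i * (truncLen (lenSeq K lam) T n : ℝ))) +
      (∑ n ∈ Finset.Icc 1 (smallStepIndex (etaSeq K lam) (lenSeq K lam) T),
        2 * √2 * lam n / √(K : ℝ)) +
      4 * √(2 * (smallStepIndex (etaSeq K lam) (lenSeq K lam) T : ℝ)) + lam 1 := by
  have hB : ∀ n, 1 ≤ lenSeq K lam n := one_le_lenSeq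
  have hG := isBlockGame etaSeq_zero (fun n hn => etaSeq_pos hlam hn) hB hloss hI T
  have hreg := hD.pseudoRegret_eq_sum_gap hB hloss hk hG
  have hpr := hD.pseudoRegret_eq (I := I) hB hloss hk T
  have hsw : switchingCost μ (lenSeq K lam) lam I T ≤ _ :=
    sum_switching_le (μ := μ) (I := I) hlam k (numBlocks (lenSeq K lam) T)
  have hN₀ := fun n => mul_truncLen_le_of_smallStepIndex_lt (η := etaSeq K lam)
    (B := lenSeq K lam) (T := T) (n := n)
  set N := numBlocks (lenSeq K lam) T
  set N₀ := smallStepIndex (etaSeq K lam) (lenSeq K lam) T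
  set η := etaSeq K lam with hη
  set c := playedLoss (lenSeq K lam) T loss
  set b : ℕ → ℝ := fun n => (truncLen (lenSeq K lam) T n : ℝ) with hb
  have hcb : ∀ n, 1 ≤ n → ∀ ω i, c n ω i ∈ Set.Icc 0 (b n) := fun n hn ω i => by
    have := hG.loss_mem n ω i
    rwa [card_playedBlock hB T hn] at this
  set G : ℕ → Ω → Fin K → ℝ := fun n ω i => if N₀ < n
    then shiftedBound (η n) (armDist η c I n ω) (c n ω) i
    else ivBound (η n) (armDist η c I n ω) (c n ω) i with hGdef
  have hGm : ∀ n, 1 ≤ n → ∀ i, BddMeasurable (history loss I n) fun ω => G n ω i := by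
    intro n hn i
    by_cases h : N₀ < n
    · simpa only [hGdef, h, if_true] using hG.bddMeasurable_shiftedBound hn i
    · simpa only [hGdef, h, if_false] using hG.bddMeasurable_ivBound hn i
  have h1 := hG.expected_regret_le hGm (fun n hn hnN ω => by
    rw [cumEst_eq_add_lossEst η (fun m => c m ω) (fun m => I m ω) hn]
    have hη' := hG.rate_pos n hn
    by_cases h : N₀ < n
    · simp only [hGdef, h, if_true]
      refine le_minObjective_add_shiftedBound hη' _ _ _ (hcb n hn ω _).1 ?_
      exact (mul_le_mul_of_nonneg_left (hcb n hn ω _).2 hη'.le).trans (hN₀ n h hnN)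
    · simp only [hGdef, h, if_false]
      exact le_minObjective_add_ivBound hη' _ _ _ (hcb n hn ω _).1) k
  rw [← hpr] at h1
  -- The contribution of the best arm to the unshifted stability term, with `√(p k) ≤ 1`.
  set E : ℕ → ℝ := fun n => if n ≤ N₀ then η n * b n ^ 2 else 0 with hE
  set q : ℕ → Fin K → ℝ := fun n i => ∫ ω, armDist η c I n ω i ∂μ with hq
  -- Summed over the blocks, the left side is twice the regret bound plus the switching bound minus
  -- the pseudo-regret itself.
  have h2 : ∀ n ∈ Finset.Icc 1 N, 2 * ∫ ω, (∑ i, armDist η c I n ω i * G n ω i +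
        (1 / η n - 1 / η (n - 1)) * (4 * ∑ i, √(armDist η c I n ω i) - 4)) ∂μ +
        ∑ i ∈ Finset.univ.erase k, (lam n + lam (n + 1) - b n * gap D i) * q n i ≤
      ∑ i ∈ Finset.univ.erase k, (11 * lam n + lam (n + 1) + 10 * √2 / √(n : ℝ)) ^ 2 /
          (4 * gap D i * b n) + E n := by
    intro n hn
    obtain ⟨hn1, hnN⟩ := Finset.mem_Icc.mp hn
    have hint : BddMeasurable mΩ fun ω => ∑ i, armDist η c I n ω i * G n ω i +
        (1 / η n - 1 / η (n - 1)) * (4 * ∑ i, √(armDist η c I n ω i) - 4) :=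
      ((BddMeasurable.sum _ fun i _ => (hG.bddMeasurable_armDist hn1 i).mul
        (hGm n hn1 i)).add
        ((((BddMeasurable.sum _ fun i _ => hG.bddMeasurable_sqrt_armDist hn1
          i).const_mul 4).sub (.const 4)).const_mul _)).mono (hG.le n)
    have hint2 : ∀ i ∈ Finset.univ.erase k, BddMeasurable mΩ fun ω =>
        (lam n + lam (n + 1) - b n * gap D i) * armDist η c I n ω i := fun i _ =>
      ((hG.bddMeasurable_armDist hn1 i).const_mul _).mono (hG.le n)
    have e1 : ∑ i ∈ Finset.univ.erase k, (lam n + lam (n + 1) - b n * gap D i) * q n i =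
        ∫ ω, ∑ i ∈ Finset.univ.erase k,
          (lam n + lam (n + 1) - b n * gap D i) * armDist η c I n ω i ∂μ := by
      rw [integral_finsetSum _ fun i hi => (hint2 i hi).integrable]
      exact Finset.sum_congr rfl fun i _ => (integral_const_mul _ _).symm
    rw [e1, ← integral_const_mul, ← integral_add (hint.const_mul 2).integrable
      (BddMeasurable.sum _ hint2).integrable]
    refine (integral_mono ((hint.const_mul 2).add (BddMeasurable.sum _ hint2)).integrable
      (integrable_const _) fun ω => ?_).trans_eq (by simp : ∫ _, (∑ i ∈ Finset.univ.erase k,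
        (11 * lam n + lam (n + 1) + 10 * √2 / √(n : ℝ)) ^ 2 / (4 * gap D i * b n) + E n) ∂μ = _)
    have hp := (tsallisDist_spec (η n) (cumEst η (fun m => c m ω) (fun m => I m ω) (n - 1))).1
    change armDist η c I n ω ∈ _ at hp
    have hpos := hG.armDist_pos hn1 ω
    dsimp only
    set p := armDist η c I n ω
    have hη' := hG.rate_pos n hn1
    have hbpos : 0 < b n := Nat.cast_pos.mpr (truncLen_pos hB hn1 hnN)
    set W := ∑ i ∈ Finset.univ.erase k, √(p i) with hW
    have hW0 : 0 ≤ W := Finset.sum_nonneg fun _ _ => Real.sqrt_nonneg _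
    have hpk1 : √(p k) ≤ 1 := Real.sqrt_le_one.mpr (tsallisDist_le_one _ _ _)
    have hsplit : ∑ i, √(p i) = √(p k) + W :=
      (Finset.add_sum_erase _ _ (Finset.mem_univ k)).symm
    have hηb : 0 ≤ η n * b n ^ 2 := by positivity
    have hstab : 2 * ∑ i, p i * G n ω i ≤ 2 * (8 / 7 * (η n * b n ^ 2) * W) + E n := by
      by_cases h : N₀ < n
      · simp only [hGdef, hE, h, if_true, not_le.mpr h, if_false]
        have := sum_mul_shiftedBound_le hη' hp hpos (hcb n hn1 ω) k
        linarith
      · simp only [hGdef, hE, h, if_false, not_lt.mp h, if_true]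
        have := sum_mul_ivBound_le hη' hpos (hcb n hn1 ω)
        rw [hsplit] at this
        have h3 : η n * b n ^ 2 * √(p k) ≤ η n * b n ^ 2 * 1 := mul_le_mul_of_nonneg_left hpk1 hηb
        have h4 := mul_nonneg hηb hW0
        linarith
    have hl := hlam n hn1
    have hl' := hlam (n + 1) (by omega)
    have hδ := inv_etaSeq_sub (K := K) (lam := lam) hn1
    set y := lam n / √(K : ℝ) + 1 / √(n : ℝ) with hy
    have hy0 : 0 ≤ y := by positivity
    have hpen : 2 * ((1 / η n - 1 / η (n - 1)) * (4 * ∑ i, √(p i) - 4)) ≤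
        2 * (3 * √2 * y * W) := by
      rw [hδ, hsplit]
      have : 3 * √2 / 4 * y * (4 * (√(p k) + W) - 4) ≤ 3 * √2 / 4 * y * (4 * W) :=
        mul_le_mul_of_nonneg_left (by linarith) (by positivity)
      linarith
    set A := 8 / 7 * (η n * b n ^ 2) + 3 * √2 * y with hA
    have hbnd : η n * b n ^ 2 ≤ 4 * √2 / 3 * y :=
      etaSeq_mul_sq_le (K := K) hlam hn1 hbpos.le (Nat.cast_le.mpr (truncLen_le _ _ _))
    have hself : ∑ i ∈ Finset.univ.erase k, (2 * (A * √(p i)) +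
        (lam n + lam (n + 1) - b n * gap D i) * p i) ≤
        ∑ i ∈ Finset.univ.erase k, (11 * lam n + lam (n + 1) + 10 * √2 / √(n : ℝ)) ^ 2 /
          (4 * gap D i * b n) := by
      refine Finset.sum_le_sum fun i hi => ?_
      have hik := Finset.ne_of_mem_erase hi
      have hgap : 0 < gap D i := (gap_nonneg D i).lt_of_ne fun h => hik ((hk i).mp h.symm)
      -- A suboptimal arm exists, so `K ≥ 2` and the factor `√2` is absorbed by `√K` in `√2 * lam n
      -- / √K ≤ lam n`.
      have hK2 : (2 : ℝ) ≤ K := by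
        have : 2 ≤ K := by
          have h1 := i.isLt
          have h2 := k.isLt
          have h3 : (i : ℕ) ≠ k := fun h => hik (Fin.ext h)
          omega
        exact_mod_cast this
      -- Here `2 A ≤ (64/21 + 6) √2 y ≤ 10 √2 y`, and the switching part raises the coefficient of
      -- `lam n` to `11`.
      have hM : 2 * A + (lam n + lam (n + 1)) ≤
          11 * lam n + lam (n + 1) + 10 * √2 / √(n : ℝ) := by
        have h5 : √2 * (lam n / √(K : ℝ)) ≤ lam n := by
          rw [mul_div_assoc', div_le_iff₀ sqrt_card_pos, mul_comm]
          exact mul_le_mul_of_nonneg_left (Real.sqrt_le_sqrt hK2) hl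
        have h6 : √2 * y ≤ lam n + √2 * (1 / √(n : ℝ)) := by
          rw [hy, mul_add]; linarith
        have h7 : 0 ≤ √2 * (1 / √(n : ℝ)) := by positivity
        have h8 : 10 * √2 / √(n : ℝ) = 10 * (√2 * (1 / √(n : ℝ))) := by ring
        rw [hA, h8]
        nlinarith
      have h9 := self_bounding_le (s := √(p i)) (d := b n * gap D i)
        ⟨Real.sqrt_nonneg _, Real.sqrt_le_one.mpr (tsallisDist_le_one _ _ _)⟩
        (mul_pos hbpos hgap) (add_nonneg hl hl') hM
      rw [Real.sq_sqrt (hpos i).le] at h9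
      rwa [mul_assoc 4, mul_comm (gap D i)]
    rw [Finset.sum_add_distrib, ← Finset.mul_sum, ← Finset.mul_sum, ← hW] at hself
    rw [hA] at hself
    linarith
  have h3 := Finset.sum_le_sum h2
  rw [Finset.sum_add_distrib, Finset.sum_add_distrib, ← Finset.mul_sum] at h3
  have h4 : ∑ n ∈ Finset.Icc 1 N, ∑ i ∈ Finset.univ.erase k,
      (lam n + lam (n + 1) - b n * gap D i) * q n i =
      ∑ n ∈ Finset.Icc 1 N, (lam n + lam (n + 1)) * μ.real {ω | I n ω ≠ k} -
        pseudoRegret μ (lenSeq K lam) loss I T := by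
    rw [hreg, ← Finset.sum_sub_distrib]
    refine Finset.sum_congr rfl fun n hn => ?_
    rw [hG.measureReal_arm_ne (Finset.mem_Icc.mp hn).1 (Finset.mem_Icc.mp hn).2, Finset.mul_sum,
      ← Finset.sum_sub_distrib]
    refine Finset.sum_congr rfl fun i _ => ?_
    simp only [hq, hb]
    ring
  have h5 : ∑ n ∈ Finset.Icc 1 N, E n ≤ ∑ n ∈ Finset.Icc 1 N₀, 2 * √2 * lam n / √(K : ℝ) +
      4 * √(2 * (N₀ : ℝ)) := by
    have hf : ∀ n ∈ Finset.Icc 1 N₀, 0 ≤ 4 * √2 / 3 * (lam n / √(K : ℝ) + 1 / √(n : ℝ)) :=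
      fun n hn => by have := hlam n (Finset.mem_Icc.mp hn).1; positivity
    calc ∑ n ∈ Finset.Icc 1 N, E n
        = ∑ n ∈ Finset.Icc 1 N with n ≤ N₀, η n * b n ^ 2 := (Finset.sum_filter _ _).symm
      _ ≤ ∑ n ∈ Finset.Icc 1 N with n ≤ N₀,
          4 * √2 / 3 * (lam n / √(K : ℝ) + 1 / √(n : ℝ)) := by
          refine Finset.sum_le_sum fun n hn => ?_
          exact etaSeq_mul_sq_le hlam (Finset.mem_Icc.mp (Finset.mem_filter.mp hn).1).1
            (Nat.cast_nonneg _) (Nat.cast_le.mpr (truncLen_le _ _ _))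
      _ ≤ ∑ n ∈ Finset.Icc 1 N₀, 4 * √2 / 3 * (lam n / √(K : ℝ) + 1 / √(n : ℝ)) := by
          refine Finset.sum_le_sum_of_subset_of_nonneg (fun n hn => ?_) fun n hn _ => hf n hn
          obtain ⟨h6, h7⟩ := Finset.mem_filter.mp hn
          exact Finset.mem_Icc.mpr ⟨(Finset.mem_Icc.mp h6).1, h7⟩
      _ = ∑ n ∈ Finset.Icc 1 N₀, 4 * √2 / 3 * (lam n / √(K : ℝ)) +
          4 * √2 / 3 * ∑ n ∈ Finset.Icc 1 N₀, 1 / √(n : ℝ) := by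
          rw [Finset.mul_sum, ← Finset.sum_add_distrib]
          simp only [mul_add]
      _ ≤ _ := by
          -- Both constants are rounded up: `4√2/3 ≤ 2√2` and `8√2/3 ≤ 4√2`.
          refine add_le_add (Finset.sum_le_sum fun n hn => ?_) ?_
          · have := hlam n (Finset.mem_Icc.mp hn).1
            have h6 : 0 ≤ √2 * (lam n / √(K : ℝ)) := by positivity
            have h7 : 2 * √2 * lam n / √(K : ℝ) = 2 * (√2 * (lam n / √(K : ℝ))) := by ring
            rw [h7]
            linarith
          · have h6 := mul_le_mul_of_nonneg_left (sum_inv_sqrt_le N₀)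
              (show 0 ≤ 4 * √2 / 3 by positivity)
            have h7 : 0 ≤ √2 * √(N₀ : ℝ) := by positivity
            rw [Real.sqrt_mul (by norm_num)]
            linarith
  rw [regretWithSwitching]
  rw [h4] at h3
  linarith

end Regret

end TsallisSwitch

open TsallisSwitch in
theorem theorem3 {K : ℕ} [NeZero K] {Ω : Type*} [MeasurableSpace Ω] (μ : Measure Ω)
    [IsProbabilityMeasure μ] (lam : ℕ → ℝ) (hlam : ∀ n, 1 ≤ n → 0 ≤ lam n)
    (loss : ℕ → Ω → Fin K → ℝ) (hloss : IsLossProcess loss) (I : ℕ → Ω → Fin K)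
    (hI : IsTsallisSwitch μ (etaSeq K lam) (lenSeq K lam) loss I) (T : ℕ) :
    regretWithSwitching μ (lenSeq K lam) lam loss I T ≤
        (∑ n ∈ Finset.Icc 1 (numBlocks (lenSeq K lam) T), 7 * lam n) +
          12 * √((K : ℝ) * (numBlocks (lenSeq K lam) T : ℝ)) + 2 ∧
      ∀ (D : Fin K → Fin K → ℝ) (istar : Fin K),
        StochasticallyConstrained μ loss D → IsUniqueBestArm D istar →
        regretWithSwitching μ (lenSeq K lam) lam loss I T ≤
          (∑ n ∈ Finset.Icc 1 (numBlocks (lenSeq K lam) T), ∑ i ∈ Finset.univ.erase istar,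
              (11 * lam n + lam (n + 1) + 10 * √2 / √(n : ℝ)) ^ 2 /
                (4 * gap D i * (truncLen (lenSeq K lam) T n : ℝ))) +
            (∑ n ∈ Finset.Icc 1 (smallStepIndex (etaSeq K lam) (lenSeq K lam) T),
              2 * √2 * lam n / √(K : ℝ)) +
            4 * √(2 * (smallStepIndex (etaSeq K lam) (lenSeq K lam) T : ℝ)) + lam 1 + 2 := by
  -- Both bounds already hold without the summand `2`.
  refine ⟨(regretWithSwitching_le_adversarial hlam hloss hI).trans
      (le_add_of_nonneg_right two_pos.le),
    fun D istar hD hk => ?_⟩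
  exact (regretWithSwitching_le_stochastic hlam hloss hI hD hk).trans
    (le_add_of_nonneg_right two_pos.le)
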